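/- Let $\Omega\subseteq\mathbb R^2$ be open and let $a\in C^6(\Omega)$ with $a>0$. Put $\tilde a:=-\ln a$, and for functions $u,f$ with $-\nabla\cdot(a\nabla u)=f$ in $\Omega$ put $\tilde f:=-f/a$. Write $\mathsf S:=[-1,1]^2\cap\mathbb Z^2$, identify $p=(p_r,p_i)\in\mathsf S$ with $p_r+\mathrm i p_i$, and set $$\partial_{\mathbb C}^{(k,\ell)}v:=\tfrac1{2^{k+\ell}}(\partial_x-\mathrm i\partial_y)^k(\partial_x+\mathrm i\partial_y)^\ell v,\qquad N^{k,\ell}(p):=\frac{(p_r+\mathrm i p_i)^k(p_r-\mathrm i p_i)^\ell}{k!\,\ell!}.$$ At a base point $x\in\Omega$ (all derivatives below are taken at $x$) let, for $k,\ell\ge1$, $$\tilde a^{k,\ell}_{m,n}:=\Big(\frac m{2k}+\frac n{2\ell}-\frac{mn}{k\ell}\Big)\binom km\binom \ell n\,\partial_{\mathbb C}^{(k-m,\ell-n)}\tilde a .$$ Define recursively $\tilde A^{k,\ell}_{m,n}:=\delta_{k,m}\delta_{\ell,n}$ and $\tilde F_{k,\ell}:=0$ if $k\ell=0$, and otherwise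 $$\tilde A^{k,\ell}_{m,n}:=\sum_{\substack{m\le i\le k,\ n\le j\le \ell\\ (i,j)\ne(k,\ell)}}\tilde a^{k,\ell}_{i,j}\tilde A^{i,j}_{m,n},\qquad \tilde F_{k,\ell}:=\sum_{\substack{0\le i\le k,\ 0\le j\le \ell\\ (i,j)\ne(k,\ell)}}\tilde a^{k,\ell}_{i,j}\tilde F_{i,j}+\tfrac14\partial_{\mathbb C}^{(k-1,\ell-1)}\tilde f .$$ Let $A^k_{m,n}(p):=\sum_{j=m}^{k-n}N^{j,k-j}(p)\tilde A^{j,k-j}_{m,n}$ and $F(p):=\sum_{0\le k+\ell\le M+1}N^{k,\ell}(p)\tilde F_{k,\ell}h^{k+\ell}$. For $M\ge0$ consider, for real unknowns $c_{p,j}$ ($p\in\mathsf S$, $0\le j\le M+1$), the linear system $$(\ast)\quad \sum_{p\in\mathsf S}A^m_{m,0}(p)\,c_{p,j}=-\sum_{k=0}^{j-1}\sum_{p\in\mathsf S}A^{m+j-k}_{m,0}(p)\,c_{p,k},\qquad 0\le j\le M+1,\ 0\le m\le M+1-j,$$ where real and imaginary parts are taken separately (the real part for $m\ge0$, the imaginary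 part for $m\ge1$). 1. For every $x\in\Omega$ and every $M\ge0$, the homogeneous system formed by the equations of $(\ast)$ with $j=0$ has a real solution $(c_{p,0})_{p\in\mathsf S}\neq0$ if and only if $M\le6$. 2. For $M=6$ one can choose, depending only on $a$ and $x$, real numbers $c_{p,j}$ ($p\in\mathsf S$, $0\le j\le7$) such that, with $C_p(h):=\sum_{j=0}^7c_{p,j}h^j$, the following hold. (i) $(c_{p,j})$ solves $(\ast)$ and $(c_{p,0})_p\ne0$. For every $K$ there is $B$, depending only on $K$, such that $|c_{p,j}|\le B$ for all $p,j$ whenever all partial derivatives of $\tilde a$ of order at most $6$ (including $\tilde a$ itself) are at most $K$ in modulus at $x$. For every $K$ there is also $B$, depending only on $K$, such that $$\Big|\sum_{p\in\mathsf S}C_p(h)\,u(x+ph)-\sum_{p\in\mathsf S}C_p(h)\,F(p)\Big|\le B\,h^8$$ whenever $0<h\le1$, $x+[-h,h]^2\subseteq\Omega$, $u\in C^8(\Omega)$ satisfies $-\nabla\cdot(a\nabla u)=f$ in $\Omega$, all partial derivatives of $\tilde a$ of order at most $6$ are at most $K$ in modulus at $x$, and all partial derivatives of $u$ of order at most $8$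 are at most $K$ in modulus on $x+[-h,h]^2$. (ii) $c_{(0,0),0}>0$, $c_{p,0}<0$, $c_{(0,0),j}\ge0$ and $c_{p,j}\le0$ for $1\le j\le7$ and all $p\in\mathsf S\setminus\{(0,0)\}$. In particular, for all $h>0$, $C_{(0,0)}(h)>0$ and $C_p(h)<0$ for all $p\in\mathsf S\setminus\{(0,0)\}$. (iii) $\sum_{p\in\mathsf S}c_{p,j}=0$ for $j=0,\dots,7$. -/

import Mathlib

noncomputable section

namespace CompactFDM

/-- The partial derivative in the first variable. -/
def dx {E : Type*} [NormedAddCommGroup E] [NormedSpace ℝ E] (v : ℝ × ℝ → E) : ℝ × ℝ → E :=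
  fun x => fderiv ℝ v x (1, 0)

/-- The partial derivative in the second variable. -/
def dy {E : Type*} [NormedAddCommGroup E] [NormedSpace ℝ E] (v : ℝ × ℝ → E) : ℝ × ℝ → E :=
  fun x => fderiv ℝ v x (0, 1)

/-- The ordinary partial derivative `∂^(k,ℓ) v = ∂^(k+ℓ) v / ∂x^k ∂y^ℓ`. -/
def pderiv (k l : ℕ) (v : ℝ × ℝ → ℝ) : ℝ × ℝ → ℝ :=
  dx^[k] (dy^[l] v)

/-- The operator `(1/2) (∂/∂x - i ∂/∂y)`. -/
def dz (v : ℝ × ℝ → ℂ) : ℝ × ℝ → ℂ :=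
  fun x => (1 / 2) * (dx v x - Complex.I * dy v x)

/-- The operator `(1/2) (∂/∂x + i ∂/∂y)`. -/
def dzbar (v : ℝ × ℝ → ℂ) : ℝ × ℝ → ℂ :=
  fun x => (1 / 2) * (dx v x + Complex.I * dy v x)

/-- The complex partial derivative of a real function,
`2^(-k-ℓ) (∂/∂x - i ∂/∂y)^k (∂/∂x + i ∂/∂y)^ℓ v`. -/
def cderiv (k l : ℕ) (v : ℝ × ℝ → ℝ) : ℝ × ℝ → ℂ :=
  dz^[k] (dzbar^[l] (fun y => (v y : ℂ)))

/-- `u` satisfies `-∇ · (a ∇u) = f` at every point of `Ω`. -/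
def SolvesPDE (Ω : Set (ℝ × ℝ)) (a f u : ℝ × ℝ → ℝ) : Prop :=
  ∀ x ∈ Ω, -(dx (fun y => a y * dx u y) x + dy (fun y => a y * dy u y) x) = f x

/-- `ã = -ln a`. -/
def aTilde (a : ℝ × ℝ → ℝ) : ℝ × ℝ → ℝ := fun y => -Real.log (a y)

/-- `f̃ = -f / a`. -/
def fTilde (a f : ℝ × ℝ → ℝ) : ℝ × ℝ → ℝ := fun y => -(f y / a y)

/-- `N^{k,ℓ}(p) = (p_r + i p_i)^k (p_r - i p_i)^ℓ / (k! ℓ!)` at an integer point `p`. -/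
def monoN (k l : ℕ) (p : ℤ × ℤ) : ℂ :=
  ((p.1 : ℂ) + Complex.I * (p.2 : ℂ)) ^ k * ((p.1 : ℂ) - Complex.I * (p.2 : ℂ)) ^ l
    / ((k.factorial : ℂ) * (l.factorial : ℂ))

/-- The index rectangle `[m,k] × [n,ℓ]` without its corner `(k,ℓ)`. -/
def rect (k l m n : ℕ) : Finset (ℕ × ℕ) :=
  (Finset.Icc m k ×ˢ Finset.Icc n l).erase (k, l)

theorem rect_lt {k l m n : ℕ} {q : ℕ × ℕ} (hq : q ∈ rect k l m n) : q.1 + q.2 < k + l := by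
  obtain ⟨i, j⟩ := q
  simp only [rect, Finset.mem_erase, Finset.mem_product, Finset.mem_Icc, ne_eq,
    Prod.mk.injEq] at hq
  simp only
  omega

/-- The coefficient `ã^{k,ℓ}_{m,n}` at the base point `x` (only used for `k, ℓ ≥ 1`);
here `w` stands for `ã`. -/
def coefa (w : ℝ × ℝ → ℝ) (x : ℝ × ℝ) (k l m n : ℕ) : ℂ :=
  ((m : ℂ) / (2 * k) + (n : ℂ) / (2 * l) - ((m : ℂ) * n) / ((k : ℂ) * l))
    * (k.choose m : ℂ) * (l.choose n : ℂ) * cderiv (k - m) (l - n) w x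

/-- The coefficient `Ã^{k,ℓ}_{m,n}` at the base point `x`; here `w` stands for `ã`. -/
def coefA (w : ℝ × ℝ → ℝ) (x : ℝ × ℝ) (m n : ℕ) (k l : ℕ) : ℂ :=
  if k * l = 0 then (if k = m ∧ l = n then 1 else 0)
  else ∑ q ∈ (rect k l m n).attach,
    coefa w x k l q.1.1 q.1.2 * coefA w x m n q.1.1 q.1.2
termination_by k + l
decreasing_by exact rect_lt q.2

/-- The quantity `F̃_{k,ℓ}` at the base point `x`; here `w`, `g` stand for `ã`, `f̃`. -/
def coefF (w g : ℝ × ℝ → ℝ) (x : ℝ × ℝ) (k l : ℕ) : ℂ :=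
  if k * l = 0 then 0
  else (∑ q ∈ (rect k l 0 0).attach, coefa w x k l q.1.1 q.1.2 * coefF w g x q.1.1 q.1.2)
    + (1 / 4) * cderiv (k - 1) (l - 1) g x
termination_by k + l
decreasing_by exact rect_lt q.2

theorem coefA_boundary (w : ℝ × ℝ → ℝ) (x : ℝ × ℝ) (m n : ℕ) {k l : ℕ} (h : k * l = 0) :
    coefA w x m n k l = if k = m ∧ l = n then 1 else 0 := by
  rw [coefA, if_pos h]

theorem coefA_rec (w : ℝ × ℝ → ℝ) (x : ℝ × ℝ) (m n : ℕ) {k l : ℕ} (h : k * l ≠ 0) :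
    coefA w x m n k l =
      ∑ q ∈ rect k l m n, coefa w x k l q.1 q.2 * coefA w x m n q.1 q.2 := by
  rw [coefA, if_neg h]
  exact Finset.sum_attach (rect k l m n)
    (fun q => coefa w x k l q.1 q.2 * coefA w x m n q.1 q.2)

theorem coefF_boundary (w g : ℝ × ℝ → ℝ) (x : ℝ × ℝ) {k l : ℕ} (h : k * l = 0) :
    coefF w g x k l = 0 := by
  rw [coefF, if_pos h]

theorem coefF_rec (w g : ℝ × ℝ → ℝ) (x : ℝ × ℝ) {k l : ℕ} (h : k * l ≠ 0) :
    coefF w g x k l =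
      (∑ q ∈ rect k l 0 0, coefa w x k l q.1 q.2 * coefF w g x q.1 q.2)
        + (1 / 4) * cderiv (k - 1) (l - 1) g x := by
  rw [coefF, if_neg h]
  congr 1
  exact Finset.sum_attach (rect k l 0 0)
    (fun q => coefa w x k l q.1 q.2 * coefF w g x q.1 q.2)

/-- `A^k_{m,n}(p) = ∑_{j=m}^{k-n} N^{j,k-j}(p) Ã^{j,k-j}_{m,n}` (an empty sum if `k < m + n`). -/
def taylorA (w : ℝ × ℝ → ℝ) (x : ℝ × ℝ) (k m n : ℕ) (p : ℤ × ℤ) : ℂ :=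
  ∑ j ∈ (Finset.range (k + 1)).filter (fun j => m ≤ j ∧ j + n ≤ k),
    monoN j (k - j) p * coefA w x m n j (k - j)

/-- `F(p) = ∑_{0 ≤ k + ℓ ≤ M + 1} N^{k,ℓ}(p) F̃_{k,ℓ} h^{k+ℓ}`. -/
def taylorF (w g : ℝ × ℝ → ℝ) (x : ℝ × ℝ) (M : ℕ) (h : ℝ) (p : ℤ × ℤ) : ℂ :=
  ∑ q ∈ (Finset.range (M + 2) ×ˢ Finset.range (M + 2)).filter (fun q => q.1 + q.2 ≤ M + 1),
    monoN q.1 q.2 p * coefF w g x q.1 q.2 * (h : ℂ) ^ (q.1 + q.2)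

/-- The nine-point reference stencil `[-1,1]² ∩ ℤ²`. -/
def stencil : Finset (ℤ × ℤ) := Finset.Icc (-1) 1 ×ˢ Finset.Icc (-1) 1

/-- The level-`j` equations (for `0 ≤ j ≤ M + 1`) of the linear system for the stencil
coefficients `c p j` at the base point `x`; here `w` stands for `ã`. -/
def InteriorSystem (w : ℝ × ℝ → ℝ) (x : ℝ × ℝ) (M : ℕ) (c : ℤ × ℤ → ℕ → ℝ) (j : ℕ) : Prop :=
  (∀ m : ℕ, m + j ≤ M + 1 →
    ∑ p ∈ stencil, (taylorA w x m m 0 p).re * c p j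
      = -∑ k ∈ Finset.range j, ∑ p ∈ stencil, (taylorA w x (m + j - k) m 0 p).re * c p k) ∧
  (∀ m : ℕ, 1 ≤ m → m + j ≤ M + 1 →
    ∑ p ∈ stencil, (taylorA w x m m 0 p).im * c p j
      = -∑ k ∈ Finset.range j, ∑ p ∈ stencil, (taylorA w x (m + j - k) m 0 p).im * c p k)

/-- `C_p(h) = ∑_{j=0}^{M+1} c_{p,j} h^j`. -/
def stencilPoly (M : ℕ) (c : ℤ × ℤ → ℕ → ℝ) (p : ℤ × ℤ) (h : ℝ) : ℝ :=
  ∑ j ∈ Finset.range (M + 2), c p j * h ^ j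

/-- The point `x + p h`. -/
def shift (x : ℝ × ℝ) (p : ℤ × ℤ) (h : ℝ) : ℝ × ℝ := (x.1 + p.1 * h, x.2 + p.2 * h)

/-- The closed square `x + [-h,h]²`. A grid point `x` is interior for the mesh size `h`
exactly when this square lies in the domain. -/
def square (x : ℝ × ℝ) (h : ℝ) : Set (ℝ × ℝ) :=
  Set.Icc (x.1 - h) (x.1 + h) ×ˢ Set.Icc (x.2 - h) (x.2 + h)

/-- All partial derivatives of `v` of order at most `n` are at most `K` in modulus at `x`. -/
def JetBound (v : ℝ × ℝ → ℝ) (n : ℕ) (K : ℝ) (x : ℝ × ℝ) : Prop :=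
  ∀ k l : ℕ, k + l ≤ n → |pderiv k l v x| ≤ K

/-- A positive diffusion coefficient of class `C⁶` on an open set: the regularity at which
every quantity in the sixth-order system is defined. -/
structure IsDiffusion (Ω : Set (ℝ × ℝ)) (a : ℝ × ℝ → ℝ) : Prop where
  isOpen : IsOpen Ω
  contDiffOn : ContDiffOn ℝ 6 a Ω
  pos : ∀ x ∈ Ω, 0 < a x

end CompactFDM

end

noncomputable section

open ComplexConjugate

namespace CompactFDM

/-! Write `z = p_r + i p_i`. At level zero the equations are the moment conditions `∑ z^m c_{p,0} =
0` for `m ≤ M + 1`, independent of `a`. For `M ≥ 7` they contain the powers `0, …, 8` of nine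
distinct complex numbers, and a Vandermonde argument leaves only zero (`eq_zero_of_interiorSystem`).
For `M ≤ 6` the weights 20 (centre), -4 (edges), -1 (corners) solve them (`lowCoeff_system_zero`).

For `M = 6`, levels one to three are overdetermined, and an explicit solution comes from a change of
unknown: `u = exp(ã/2) v` turns the homogeneous equation into `∂∂̄v = (q/4) v` with `q = ∂ã ∂̄ã - 2
∂∂̄ã`. A stencil for `v` is easy to write down to third order, and multiplying its weight at each
node by the expansion of `exp(-(ã - ã(x))/2)` there gives a stencil for `u`. This only motivates the
formula `lowCoeff`; the equations are then checked as polynomial identities in the derivatives of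
`ã` (`lowCoeff_system`). From level four on only moments of order at most three are prescribed, and
`momentStencil` attains any such moments, provided that the zeroth one is zero
(`levelSystem_extendLevel`).

The signs come from a symmetry: the equations say that coefficients of power series in `h` vanish,
so they survive multiplication of all `C_p(h)` by one scalar series. With the geometric series of a
large ratio `R`, the signs at level zero spread to every level (`LevelSystem.geomProduct`).

For consistency, the differential equation expresses all derivatives of `u` of order at most 7
through the pure ones `∂^m u`, `∂̄^n u` and the data (`cderiv_eq_sum_axes`). In the Taylor expansion
of `∑ C_p(h) u(x + ph)`, the coefficient of each pure derivative vanishes up to order `h^7` by the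
equations (`sum_taylorA_eq_zero`, and conjugation), which leaves `O(h^8)`. Constants are tracked by
`JetBounded`: every quantity is built by ring operations, real parts, norms and finite sums from
derivatives of `ã` of order at most 6. -/

/-! ### The recursive coefficients: support and special values. -/

theorem coefa_zero_zero (w : ℝ × ℝ → ℝ) (x : ℝ × ℝ) (k l : ℕ) : coefa w x k l 0 0 = 0 := by
  simp [coefa]

theorem coefA_eq_zero (w : ℝ × ℝ → ℝ) (x : ℝ × ℝ) {m n k l : ℕ} (h : k < m ∨ l < n) :
    coefA w x m n k l = 0 := by
  by_cases hkl : k * l = 0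
  · rw [coefA_boundary _ _ _ _ hkl, if_neg (by omega)]
  · rw [coefA_rec _ _ _ _ hkl]
    have : rect k l m n = ∅ := by
      ext ⟨i, j⟩
      simp [rect]
      omega
    simp [this]

/-- The added terms vanish by `coefA_eq_zero`. A range of summation independent of `(m, n)` is what
allows sums to be interchanged later. -/
theorem coefA_rec_full (w : ℝ × ℝ → ℝ) (x : ℝ × ℝ) (m n : ℕ) {k l : ℕ} (h : k * l ≠ 0) :
    coefA w x m n k l =
      ∑ q ∈ rect k l 0 0, coefa w x k l q.1 q.2 * coefA w x m n q.1 q.2 := by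
  rw [coefA_rec _ _ _ _ h]
  refine Finset.sum_subset ?_ ?_
  · rintro ⟨i, j⟩
    simp [rect]
    omega
  · rintro ⟨i, j⟩ h1 h2
    rw [coefA_eq_zero, mul_zero]
    simp [rect] at h1 h2 ⊢
    omega

theorem coefA_self (w : ℝ × ℝ → ℝ) (x : ℝ × ℝ) (k : ℕ) : coefA w x k 0 k 0 = 1 := by
  rw [coefA_boundary _ _ _ _ (by simp)]; simp

theorem coefA_axis (w : ℝ × ℝ → ℝ) (x : ℝ × ℝ) {k m : ℕ} (h : k ≠ m) :
    coefA w x m 0 k 0 = 0 := by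
  rw [coefA_boundary _ _ _ _ (by simp)]; simp [h]

/-- Constants solve the homogeneous equation. In the recursion, induction leaves only the summand at
`(0, 0)`, whose coefficient is zero. -/
theorem coefA_zero_zero (w : ℝ × ℝ → ℝ) (x : ℝ × ℝ) (k l : ℕ) :
    coefA w x 0 0 k l = if k = 0 ∧ l = 0 then 1 else 0 := by
  induction hn : k + l using Nat.strong_induction_on generalizing k l with
  | _ n ih =>
    by_cases hkl : k * l = 0
    · rw [coefA_boundary _ _ _ _ hkl]
    · rw [coefA_rec _ _ _ _ hkl, if_neg (by rintro ⟨rfl, rfl⟩; simp at hkl)]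
      refine Finset.sum_eq_zero ?_
      rintro ⟨i, j⟩ hq
      have := rect_lt hq
      simp only at this ⊢
      rw [ih _ (hn ▸ this) _ _ rfl]
      split_ifs with h0
      · rw [h0.1, h0.2, coefa_zero_zero, zero_mul]
      · simp

/-! ### Closed forms of the coefficients needed at levels one to three. -/

section LowOrder

variable (w : ℝ × ℝ → ℝ) (x : ℝ × ℝ) {m : ℕ}

/-- Here and below `m ≥ 1` is essential: for `m = 0` the upper index lies on an axis and the
recursion does not apply. -/
theorem coefA_zero_one (hm : 1 ≤ m) : coefA w x m 0 m 1 = cderiv 0 1 w x / 2 := by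
  have h0 : (m : ℂ) ≠ 0 := by exact_mod_cast (by omega : m ≠ 0)
  rw [coefA_rec _ _ _ _ (by simp; omega)]
  have : rect m 1 m 0 = {(m, 0)} := by
    ext ⟨i, j⟩; simp [rect]; omega
  rw [this, Finset.sum_singleton]
  simp only [coefA_self, coefa]
  simp
  field_simp

theorem coefA_zero_two (hm : 1 ≤ m) :
    coefA w x m 0 m 2 = cderiv 0 2 w x / 2 + cderiv 0 1 w x ^ 2 / 4 := by
  have h0 : (m : ℂ) ≠ 0 := by exact_mod_cast (by omega : m ≠ 0)
  rw [coefA_rec _ _ _ _ (by simp; omega)]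
  have : rect m 2 m 0 = {(m, 0), (m, 1)} := by
    ext ⟨i, j⟩; simp [rect]; omega
  rw [this, Finset.sum_pair (by simp)]
  simp only [coefA_self, coefA_zero_one w x hm, coefa]
  simp
  field_simp
  ring

theorem coefA_zero_three (hm : 1 ≤ m) :
    coefA w x m 0 m 3 = cderiv 0 3 w x / 2 + 3 / 4 * cderiv 0 1 w x * cderiv 0 2 w x
      + cderiv 0 1 w x ^ 3 / 8 := by
  have h0 : (m : ℂ) ≠ 0 := by exact_mod_cast (by omega : m ≠ 0)
  rw [coefA_rec _ _ _ _ (by simp; omega)]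
  have : rect m 3 m 0 = {(m, 0), (m, 1), (m, 2)} := by
    ext ⟨i, j⟩; simp [rect]; omega
  rw [this, Finset.sum_insert (by simp), Finset.sum_pair (by simp)]
  simp only [coefA_self, coefA_zero_one w x hm, coefA_zero_two w x hm, coefa]
  simp
  field_simp
  ring

theorem coefA_one_one (hm : 1 ≤ m) :
    coefA w x m 0 (m + 1) 1 = m / 2 * cderiv 1 1 w x + cderiv 1 0 w x * cderiv 0 1 w x / 4 := by
  have h0 : (m : ℂ) ≠ 0 := by exact_mod_cast (by omega : m ≠ 0)
  have h1 : (m + 1 : ℂ) ≠ 0 := by exact_mod_cast (by omega : m + 1 ≠ 0)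
  rw [coefA_rec _ _ _ _ (by simp)]
  have : rect (m + 1) 1 m 0 = {(m, 0), (m, 1), (m + 1, 0)} := by
    ext ⟨i, j⟩; simp [rect]; omega
  rw [this, Finset.sum_insert (by simp), Finset.sum_pair (by simp)]
  simp only [coefA_self, coefA_zero_one w x hm, coefA_axis w x (show m + 1 ≠ m by omega), coefa]
  simp
  field_simp
  ring

theorem coefA_one_two (hm : 1 ≤ m) :
    coefA w x m 0 (m + 1) 2 = m / 2 * cderiv 1 2 w x
      + (m + 1) / 4 * cderiv 1 1 w x * cderiv 0 1 w x
      + cderiv 1 0 w x / 2 * (cderiv 0 2 w x / 2 + cderiv 0 1 w x ^ 2 / 4)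
      + cderiv 0 1 w x / 2 * (m / 2 * cderiv 1 1 w x + cderiv 1 0 w x * cderiv 0 1 w x / 4) := by
  have h0 : (m : ℂ) ≠ 0 := by exact_mod_cast (by omega : m ≠ 0)
  have h1 : (m + 1 : ℂ) ≠ 0 := by exact_mod_cast (by omega : m + 1 ≠ 0)
  rw [coefA_rec _ _ _ _ (by simp)]
  have : rect (m + 1) 2 m 0 = {(m, 0), (m, 1), (m, 2), (m + 1, 0), (m + 1, 1)} := by
    ext ⟨i, j⟩; simp [rect]; omega
  rw [this, Finset.sum_insert (by simp), Finset.sum_insert (by simp), Finset.sum_insert (by simp),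
    Finset.sum_pair (by simp)]
  simp only [coefA_self, coefA_zero_one w x hm, coefA_zero_two w x hm, coefA_one_one w x hm,
    coefA_axis w x (show m + 1 ≠ m by omega), coefa]
  simp
  field_simp
  ring

theorem coefA_two_one (hm : 1 ≤ m) :
    coefA w x m 0 (m + 2) 1 = m * (m + 1) / 4 * cderiv 2 1 w x
      + (m + 1) / 4 * cderiv 2 0 w x * cderiv 0 1 w x
      + cderiv 1 0 w x / 2 * (m / 2 * cderiv 1 1 w x + cderiv 1 0 w x * cderiv 0 1 w x / 4) := by
  have h0 : (m : ℂ) ≠ 0 := by exact_mod_cast (by omega : m ≠ 0)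
  have h1 : (m + 2 : ℂ) ≠ 0 := by exact_mod_cast (by omega : m + 2 ≠ 0)
  have hc : ((m + 2).choose m : ℂ) = (m + 2) * (m + 1) / 2 := by
    rw [show (m + 2).choose m = (m + 2).choose 2 from Nat.choose_symm_add, Nat.cast_choose_two]
    push_cast
    ring
  have hc1 : ((m + 2).choose (m + 1) : ℂ) = m + 2 := by
    rw [Nat.choose_succ_self_right]
    push_cast
    ring
  rw [coefA_rec _ _ _ _ (by simp)]
  have : rect (m + 2) 1 m 0 = {(m, 0), (m, 1), (m + 1, 0), (m + 1, 1), (m + 2, 0)} := by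
    ext ⟨i, j⟩; simp [rect]; omega
  rw [this, Finset.sum_insert (by simp), Finset.sum_insert (by simp), Finset.sum_insert (by simp),
    Finset.sum_pair (by simp)]
  simp only [coefA_self, coefA_zero_one w x hm, coefA_one_one w x hm,
    coefA_axis w x (show m + 1 ≠ m by omega), coefA_axis w x (show m + 2 ≠ m by omega), coefa,
    hc, hc1]
  simp
  field_simp
  ring

end LowOrder

/-! ### The homogeneous polynomials multiplying the pure derivatives. -/

theorem taylorA_eq_sum (w : ℝ × ℝ → ℝ) (x : ℝ × ℝ) (k m n : ℕ) (p : ℤ × ℤ) :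
    taylorA w x k m n p =
      ∑ j ∈ Finset.range (k + 1), monoN j (k - j) p * coefA w x m n j (k - j) := by
  rw [taylorA]
  refine Finset.sum_subset (Finset.filter_subset _ _) fun j hj hj' => ?_
  rw [coefA_eq_zero, mul_zero]
  simp at hj hj'
  omega

theorem taylorA_add (w : ℝ × ℝ → ℝ) (x : ℝ × ℝ) (m j : ℕ) (p : ℤ × ℤ) :
    taylorA w x (m + j) m 0 p =
      ∑ s ∈ Finset.range (j + 1), monoN (m + s) (j - s) p * coefA w x m 0 (m + s) (j - s) := by
  rw [taylorA_eq_sum, show m + j + 1 = m + (j + 1) by ring, Finset.sum_range_add,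
    Finset.sum_eq_zero, zero_add]
  · refine Finset.sum_congr rfl fun s _ => ?_
    rw [show m + j - (m + s) = j - s by omega]
  · intro i hi
    rw [coefA_eq_zero, mul_zero]
    simp at hi
    omega

theorem taylorA_eq_zero (w : ℝ × ℝ → ℝ) (x : ℝ × ℝ) {k m n : ℕ} (h : k < m + n) (p : ℤ × ℤ) :
    taylorA w x k m n p = 0 := by
  rw [taylorA]
  refine Finset.sum_eq_zero fun j hj => ?_
  simp at hj
  omega

theorem taylorA_zero_zero (w : ℝ × ℝ → ℝ) (x : ℝ × ℝ) (k : ℕ) (p : ℤ × ℤ) :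
    taylorA w x k 0 0 p = if k = 0 then 1 else 0 := by
  rw [taylorA_eq_sum]
  split_ifs with hk
  · subst hk
    simp [coefA_zero_zero, monoN]
  · refine Finset.sum_eq_zero fun j hj => ?_
    rw [coefA_zero_zero, if_neg, mul_zero]
    omega

theorem taylorA_self (w : ℝ × ℝ → ℝ) (x : ℝ × ℝ) (m : ℕ) (p : ℤ × ℤ) :
    taylorA w x m m 0 p = monoN m 0 p := by
  have := taylorA_add w x m 0 p
  simpa [coefA_self] using this

/-! ### Explicit stencil weights at levels zero to three. -/

theorem sum_stencil {E : Type*} [AddCommMonoid E] (f : ℤ × ℤ → E) :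
    ∑ p ∈ stencil, f p = f (-1, -1) + f (-1, 0) + f (-1, 1) + f (0, -1) + f (0, 0) + f (0, 1)
      + f (1, -1) + f (1, 0) + f (1, 1) := by
  have h : stencil = {(-1, -1), (-1, 0), (-1, 1), (0, -1), (0, 0), (0, 1), (1, -1), (1, 0),
    (1, 1)} := by decide
  rw [h]
  repeat rw [Finset.sum_insert (by decide)]
  rw [Finset.sum_singleton]
  abel

/-- The weight with value `c` at the centre, `e` at the edge midpoints and `d` at the corners. -/
def symWeight (c e d : ℂ) (p : ℤ × ℤ) : ℂ :=
  if p = (0, 0) then c else if p.1 = 0 ∨ p.2 = 0 then e else d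

/-- The homogeneous part of degree `k` of the Taylor polynomial of `w` at `x`. -/
def taylorPart (w : ℝ × ℝ → ℝ) (x : ℝ × ℝ) (k : ℕ) (p : ℤ × ℤ) : ℂ :=
  ∑ i ∈ Finset.range (k + 1), monoN i (k - i) p * cderiv i (k - i) w x

/-- Solutions of `-∇ · (a ∇u) = 0` are `exp (ã / 2)` times solutions of
`∂ ∂̄ v = (potential / 4) v`. -/
def potential (w : ℝ × ℝ → ℝ) (x : ℝ × ℝ) : ℂ :=
  cderiv 1 0 w x * cderiv 0 1 w x - 2 * cderiv 1 1 w x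

/-- The derivative `∂ potential`. -/
def potentialDz (w : ℝ × ℝ → ℝ) (x : ℝ × ℝ) : ℂ :=
  cderiv 2 0 w x * cderiv 0 1 w x + cderiv 1 0 w x * cderiv 1 1 w x - 2 * cderiv 2 1 w x

/-- The derivative `∂̄ potential`. -/
def potentialDzbar (w : ℝ × ℝ → ℝ) (x : ℝ × ℝ) : ℂ :=
  cderiv 1 1 w x * cderiv 0 1 w x + cderiv 1 0 w x * cderiv 0 2 w x - 2 * cderiv 1 2 w x

/-- Stencil coefficients for `∂ ∂̄ v = (potential / 4) v`. -/
def schrodingerCoeff (w : ℝ × ℝ → ℝ) (x : ℝ × ℝ) : ℕ → ℤ × ℤ → ℂ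
  | 0, p => symWeight 20 (-4) (-1) p
  | 2, p => potential w x * symWeight (29 / 5) 0 (1 / 20) p
  | 3, p =>
    (potentialDzbar w x * monoN 0 1 p + potentialDz w x * monoN 1 0 p)
        * symWeight 0 (1 / 3) (1 / 12) p
      - (potentialDz w x * monoN 0 3 p + potentialDzbar w x * monoN 3 0 p)
        * symWeight 0 (2 / 5) (1 / 10) p
  | _, _ => 0

/-- The expansion of `exp (-(w - w x) / 2)` at `x`, up to order three. -/
def gaugeCoeff (w : ℝ × ℝ → ℝ) (x : ℝ × ℝ) : ℕ → ℤ × ℤ → ℂ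
  | 0, _ => 1
  | 1, p => -taylorPart w x 1 p / 2
  | 2, p => -taylorPart w x 2 p / 2 + taylorPart w x 1 p ^ 2 / 8
  | 3, p => -taylorPart w x 3 p / 2 + taylorPart w x 1 p * taylorPart w x 2 p / 4
      - taylorPart w x 1 p ^ 3 / 48
  | _, _ => 0

/-- Stencil coefficients of level at most three. -/
def lowCoeff (w : ℝ × ℝ → ℝ) (x : ℝ × ℝ) (j : ℕ) (p : ℤ × ℤ) : ℂ :=
  ∑ k ∈ Finset.range (j + 1), gaugeCoeff w x (j - k) p * schrodingerCoeff w x k p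

theorem I_pow_three : Complex.I ^ 3 = -Complex.I := by
  rw [pow_succ, Complex.I_sq]; ring

theorem I_pow_five : Complex.I ^ 5 = Complex.I := by
  rw [pow_succ, Complex.I_pow_four]; ring

theorem I_pow_six : Complex.I ^ 6 = -1 := by
  rw [pow_succ, I_pow_five, Complex.I_mul_I]

/-- The weights are invariant under quarter turns, so only `m = 0` and `m = 4` can give a nonzero
moment. Since `z^4` is 1 on the edges and -4 at the corners, these two are `20 - 16 - 4 = 0` and, up
to the factorial, `-16 + 16 = 0`. -/
theorem lowCoeff_system_zero (w : ℝ × ℝ → ℝ) (x : ℝ × ℝ) {m : ℕ} (hm : m ≤ 7) :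
    ∑ p ∈ stencil, taylorA w x m m 0 p * lowCoeff w x 0 p = 0 := by
  simp only [sum_stencil, taylorA_self, monoN, lowCoeff, gaugeCoeff, schrodingerCoeff,
    Finset.sum_range_succ, Finset.sum_range_zero, symWeight]
  interval_cases m <;> norm_num [Nat.factorial] <;> ring_nf <;>
    simp only [Complex.I_sq, I_pow_three, Complex.I_pow_four, I_pow_six] <;>
    ring

/-- Levels one, two and three impose 13, 11 and 9 real equations on nine unknowns, and at level
three the imaginary part for `m = 4` has zero left-hand side because `z^4` is real on the stencil.
Solvability is thus a condition on the lower levels, which the gauge ansatz meets. -/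
theorem lowCoeff_system_one (w : ℝ × ℝ → ℝ) (x : ℝ × ℝ) {m : ℕ} (h1 : 1 ≤ m) (hm : m ≤ 6) :
    ∑ k ∈ Finset.range 2,
      ∑ p ∈ stencil, taylorA w x (m + (1 - k)) m 0 p * lowCoeff w x k p = 0 := by
  simp only [Finset.sum_range_succ, Finset.sum_range_zero, Nat.sub_zero, Nat.sub_self, taylorA_add,
    coefA_self, coefA_zero_one w x h1, lowCoeff, add_zero,
    coefA_axis w x (show m + 1 ≠ m by omega)]
  simp only [sum_stencil, monoN, gaugeCoeff, schrodingerCoeff, taylorPart,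
    Finset.sum_range_succ, Finset.sum_range_zero, symWeight]
  interval_cases m <;> norm_num [Nat.factorial] <;> ring_nf <;>
    simp only [Complex.I_sq, Complex.I_pow_four, I_pow_six] <;>
    ring

-- The constants are read off in the variable `v`, where the level-two term for `z^m / m!` is `(q/4)
-- z^(m+1) z̄ / (m+1)!`. The level-zero weights send it to `-6q` for `m = 0` and to `q/30` for `m =
-- 4`. The weights `29/5, 0, 1/20` times `q` cancel both: `29/5 + 4/20 = 6` and `-16/(20 · 24) =
-- -1/30`. The edge weight 0 is a normalization, as multiples of the level-zero weights may be
-- added.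
set_option maxHeartbeats 4000000 in
theorem lowCoeff_system_two (w : ℝ × ℝ → ℝ) (x : ℝ × ℝ) {m : ℕ} (h1 : 1 ≤ m) (hm : m ≤ 5) :
    ∑ k ∈ Finset.range 3,
      ∑ p ∈ stencil, taylorA w x (m + (2 - k)) m 0 p * lowCoeff w x k p = 0 := by
  simp only [Finset.sum_range_succ, Finset.sum_range_zero, Nat.sub_zero, Nat.sub_self, taylorA_add,
    coefA_self, coefA_zero_one w x h1, coefA_zero_two w x h1, coefA_one_one w x h1, lowCoeff,
    add_zero, coefA_axis w x (show m + 1 ≠ m by omega), coefA_axis w x (show m + 2 ≠ m by omega),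
    Nat.reduceSub]
  simp only [sum_stencil, monoN, gaugeCoeff, schrodingerCoeff, taylorPart, potential,
    Finset.sum_range_succ, Finset.sum_range_zero, symWeight]
  interval_cases m <;> norm_num [Nat.factorial] <;> ring_nf <;>
    simp only [Complex.I_sq, I_pow_three, Complex.I_pow_four, I_pow_five, I_pow_six] <;>
    ring

set_option maxHeartbeats 4000000 in
theorem lowCoeff_system_three (w : ℝ × ℝ → ℝ) (x : ℝ × ℝ) {m : ℕ} (h1 : 1 ≤ m) (hm : m ≤ 4) :
    ∑ k ∈ Finset.range 4,
      ∑ p ∈ stencil, taylorA w x (m + (3 - k)) m 0 p * lowCoeff w x k p = 0 := by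
  simp only [Finset.sum_range_succ, Finset.sum_range_zero, Nat.sub_zero, Nat.sub_self, taylorA_add,
    coefA_self, coefA_zero_one w x h1, coefA_zero_two w x h1, coefA_zero_three w x h1,
    coefA_one_one w x h1, coefA_one_two w x h1, coefA_two_one w x h1, lowCoeff,
    add_zero, coefA_axis w x (show m + 1 ≠ m by omega), coefA_axis w x (show m + 2 ≠ m by omega),
    coefA_axis w x (show m + 3 ≠ m by omega), Nat.reduceSub]
  simp only [sum_stencil, monoN, gaugeCoeff, schrodingerCoeff, taylorPart, potential, potentialDz,
    potentialDzbar, Finset.sum_range_succ, Finset.sum_range_zero, symWeight]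
  interval_cases m <;> norm_num [Nat.factorial] <;> ring_nf <;>
    simp only [Complex.I_sq, I_pow_three, Complex.I_pow_four, I_pow_five, I_pow_six] <;>
    ring

/-! ### Reality of the weights and bounds in terms of the jet of `ã`. -/

/-- The complex derivatives of `w` at `x` of order at most six are those of a real function. -/
def RealJet (w : ℝ × ℝ → ℝ) (x : ℝ × ℝ) : Prop :=
  ∀ k l : ℕ, k + l ≤ 6 → conj (cderiv k l w x) = cderiv l k w x

/-- A quantity depending on `w` and `x` is bounded in terms of a bound for the complex derivatives
of `w` at `x` of order at most six. -/
def JetBounded {E : Type*} [Norm E] (g : (ℝ × ℝ → ℝ) → ℝ × ℝ → E) : Prop :=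
  ∀ K : ℝ, ∃ B : ℝ, ∀ w x, (∀ k l : ℕ, k + l ≤ 6 → ‖cderiv k l w x‖ ≤ K) → ‖g w x‖ ≤ B

namespace JetBounded

variable {E : Type*}

theorem const [Norm E] (a : E) : JetBounded fun _ _ => a :=
  fun _ => ⟨‖a‖, fun _ _ _ => le_rfl⟩

theorem cderiv {k l : ℕ} (h : k + l ≤ 6) : JetBounded (cderiv k l) :=
  fun K => ⟨K, fun _ _ hw => hw k l h⟩

theorem add [SeminormedAddCommGroup E] {f g : (ℝ × ℝ → ℝ) → ℝ × ℝ → E} (hf : JetBounded f)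
    (hg : JetBounded g) : JetBounded fun w x => f w x + g w x := fun K => by
  obtain ⟨A, hA⟩ := hf K
  obtain ⟨B, hB⟩ := hg K
  exact ⟨A + B, fun w x h => (norm_add_le _ _).trans (add_le_add (hA w x h) (hB w x h))⟩

theorem neg [SeminormedAddCommGroup E] {f : (ℝ × ℝ → ℝ) → ℝ × ℝ → E} (hf : JetBounded f) :
    JetBounded fun w x => -f w x := fun K => by
  obtain ⟨A, hA⟩ := hf K
  exact ⟨A, fun w x h => (norm_neg _).trans_le (hA w x h)⟩

theorem sub [SeminormedAddCommGroup E] {f g : (ℝ × ℝ → ℝ) → ℝ × ℝ → E} (hf : JetBounded f)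
    (hg : JetBounded g) : JetBounded fun w x => f w x - g w x := by
  simpa only [sub_eq_add_neg] using hf.add hg.neg

theorem mul [SeminormedRing E] {f g : (ℝ × ℝ → ℝ) → ℝ × ℝ → E} (hf : JetBounded f)
    (hg : JetBounded g) : JetBounded fun w x => f w x * g w x := fun K => by
  obtain ⟨A, hA⟩ := hf K
  obtain ⟨B, hB⟩ := hg K
  exact ⟨A * B, fun w x h => (norm_mul_le _ _).trans
    (mul_le_mul (hA w x h) (hB w x h) (norm_nonneg _) ((norm_nonneg _).trans (hA w x h)))⟩

theorem pow [SeminormedRing E] {f : (ℝ × ℝ → ℝ) → ℝ × ℝ → E} (hf : JetBounded f) (n : ℕ) :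
    JetBounded fun w x => f w x ^ n := by
  induction n with
  | zero => simpa only [pow_zero] using const 1
  | succ n ih => simpa only [pow_succ] using ih.mul hf

theorem div_const {f : (ℝ × ℝ → ℝ) → ℝ × ℝ → ℂ} (hf : JetBounded f) (a : ℂ) :
    JetBounded fun w x => f w x / a := by
  simpa only [div_eq_mul_inv] using hf.mul (const a⁻¹)

theorem sum [SeminormedAddCommGroup E] {ι : Type*} (s : Finset ι)
    {f : ι → (ℝ × ℝ → ℝ) → ℝ × ℝ → E} (hf : ∀ i ∈ s, JetBounded (f i)) :
    JetBounded fun w x => ∑ i ∈ s, f i w x := by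
  classical
  induction s using Finset.induction_on with
  | empty => simpa using const (0 : E)
  | insert i s hi ih =>
    simp only [Finset.sum_insert hi]
    exact (hf i (Finset.mem_insert_self i s)).add
      (ih fun j hj => hf j (Finset.mem_insert_of_mem hj))

theorem norm [SeminormedAddCommGroup E] {f : (ℝ × ℝ → ℝ) → ℝ × ℝ → E} (hf : JetBounded f) :
    JetBounded fun w x => ‖f w x‖ := fun K => by
  obtain ⟨A, hA⟩ := hf K
  exact ⟨A, fun w x h => (norm_norm _).trans_le (hA w x h)⟩

theorem re {f : (ℝ × ℝ → ℝ) → ℝ × ℝ → ℂ} (hf : JetBounded f) :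
    JetBounded fun w x => (f w x).re := fun K => by
  obtain ⟨A, hA⟩ := hf K
  exact ⟨A, fun w x h => (Complex.abs_re_le_norm _).trans (hA w x h)⟩

theorem ofReal {f : (ℝ × ℝ → ℝ) → ℝ × ℝ → ℝ} (hf : JetBounded f) :
    JetBounded fun w x => (f w x : ℂ) := fun K => by
  obtain ⟨A, hA⟩ := hf K
  exact ⟨A, fun w x h => (Complex.norm_real _).trans_le (hA w x h)⟩

/-- For `k + l = 7` only the index `(0, 0)` would call for a derivative of order 7, and there the
prefactor is zero. Outside the rectangle a binomial coefficient vanishes. -/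
theorem coefa {k l m n : ℕ} (h : k + l ≤ 7) :
    JetBounded fun w x => coefa w x k l m n := by
  by_cases h0 : m = 0 ∧ n = 0
  · obtain ⟨rfl, rfl⟩ := h0
    simpa only [coefa_zero_zero] using const (0 : ℂ)
  · by_cases hmn : m ≤ k ∧ n ≤ l
    · exact (const _).mul (cderiv (by omega))
    · have : (k.choose m : ℂ) * (l.choose n : ℂ) = 0 := by
        rw [not_and_or, not_le, not_le] at hmn
        rcases hmn with hmn | hmn <;> simp [Nat.choose_eq_zero_of_lt hmn]
      simp only [CompactFDM.coefa, mul_assoc _ (k.choose m : ℂ), this, mul_zero, zero_mul]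
      exact const 0

theorem coefA (m n : ℕ) {k l : ℕ} (h : k + l ≤ 7) :
    JetBounded fun w x => coefA w x m n k l := by
  induction hn : k + l using Nat.strong_induction_on generalizing k l with
  | _ N ih =>
    by_cases hkl : k * l = 0
    · simp only [coefA_boundary _ _ _ _ hkl]
      exact const _
    · simp only [coefA_rec _ _ _ _ hkl]
      refine sum _ fun q hq => (coefa h).mul ?_
      have := rect_lt hq
      exact ih _ (hn ▸ this) (by omega) rfl

theorem taylorA {k : ℕ} (hk : k ≤ 7) (m n : ℕ) (p : ℤ × ℤ) :
    JetBounded fun w x => taylorA w x k m n p := by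
  simp only [taylorA_eq_sum]
  refine sum _ fun j hj => (const _).mul (coefA _ _ ?_)
  simp at hj
  omega

theorem taylorPart {k : ℕ} (hk : k ≤ 6) (p : ℤ × ℤ) :
    JetBounded fun w x => taylorPart w x k p := by
  refine sum _ fun i hi => (const _).mul (cderiv ?_)
  simp at hi
  omega

theorem potential : JetBounded potential :=
  ((cderiv (by norm_num)).mul (cderiv (by norm_num))).sub ((const _).mul (cderiv (by norm_num)))

theorem potentialDz : JetBounded potentialDz :=
  (((cderiv (by norm_num)).mul (cderiv (by norm_num))).add
    ((cderiv (by norm_num)).mul (cderiv (by norm_num)))).sub ((const _).mul (cderiv (by norm_num)))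

theorem potentialDzbar : JetBounded potentialDzbar :=
  (((cderiv (by norm_num)).mul (cderiv (by norm_num))).add
    ((cderiv (by norm_num)).mul (cderiv (by norm_num)))).sub ((const _).mul (cderiv (by norm_num)))

theorem schrodingerCoeff (j : ℕ) (p : ℤ × ℤ) :
    JetBounded fun w x => schrodingerCoeff w x j p := by
  match j with
  | 0 => exact const _
  | 1 => exact const _
  | 2 => exact potential.mul (const _)
  | 3 =>
    have h1 := (potentialDzbar.mul (const (monoN 0 1 p))).add
      (potentialDz.mul (const (monoN 1 0 p)))
    have h2 := (potentialDz.mul (const (monoN 0 3 p))).add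
      (potentialDzbar.mul (const (monoN 3 0 p)))
    exact (h1.mul (const _)).sub (h2.mul (const _))
  | _ + 4 => exact const _

theorem gaugeCoeff (j : ℕ) (p : ℤ × ℤ) : JetBounded fun w x => gaugeCoeff w x j p := by
  have h1 := taylorPart (k := 1) (by norm_num) p
  have h2 := taylorPart (k := 2) (by norm_num) p
  have h3 := taylorPart (k := 3) (by norm_num) p
  match j with
  | 0 => exact const _
  | 1 => exact h1.neg.div_const _
  | 2 => exact (h2.neg.div_const _).add ((h1.pow 2).div_const _)
  | 3 => exact ((h3.neg.div_const _).add ((h1.mul h2).div_const _)).sub ((h1.pow 3).div_const _)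
  | _ + 4 => exact const _

theorem lowCoeff (j : ℕ) (p : ℤ × ℤ) : JetBounded fun w x => lowCoeff w x j p :=
  sum _ fun _ _ => (gaugeCoeff _ p).mul (schrodingerCoeff _ p)

end JetBounded

theorem conj_monoN (k l : ℕ) (p : ℤ × ℤ) : conj (monoN k l p) = monoN l k p := by
  simp only [monoN, map_div₀, map_mul, map_pow, map_add, map_sub, Complex.conj_I, map_intCast,
    map_natCast]
  ring

theorem conj_symWeight (c e d : ℝ) (p : ℤ × ℤ) : conj (symWeight c e d p) = symWeight c e d p := by
  unfold symWeight
  split_ifs <;> exact Complex.conj_ofReal _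

theorem RealJet.conj_taylorPart {w : ℝ × ℝ → ℝ} {x : ℝ × ℝ} (h : RealJet w x) {k : ℕ} (hk : k ≤ 6)
    (p : ℤ × ℤ) : conj (taylorPart w x k p) = taylorPart w x k p := by
  rw [taylorPart, map_sum, ← Finset.sum_range_reflect]
  refine Finset.sum_congr rfl fun i hi => ?_
  rw [Finset.mem_range] at hi
  rw [map_mul, conj_monoN, h _ _ (by omega), show k + 1 - 1 - i = k - i by omega,
    show k - (k - i) = i by omega]

/-- Conjugation fixes the potential and exchanges its two first derivatives as well as `z` and `z̄`,
so the terms pair up. Hence nothing is lost when real parts are taken in `solution`. -/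
theorem RealJet.conj_lowCoeff {w : ℝ × ℝ → ℝ} {x : ℝ × ℝ} (h : RealJet w x) (j : ℕ)
    (p : ℤ × ℤ) : conj (lowCoeff w x j p) = lowCoeff w x j p := by
  have hq : conj (potential w x) = potential w x := by
    simp only [potential, map_sub, map_mul, h 1 0 (by norm_num), h 0 1 (by norm_num),
      h 1 1 (by norm_num), map_ofNat]
    ring
  have hz : conj (potentialDz w x) = potentialDzbar w x := by
    simp only [potentialDz, potentialDzbar, map_sub, map_add, map_mul, h 1 0 (by norm_num),
      h 0 1 (by norm_num), h 1 1 (by norm_num), h 2 0 (by norm_num), h 2 1 (by norm_num),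
      map_ofNat]
    ring
  have hzb : conj (potentialDzbar w x) = potentialDz w x := by
    rw [← hz, Complex.conj_conj]
  have s0 := conj_symWeight 20 (-4) (-1) p
  have s1 := conj_symWeight (29 / 5) 0 (1 / 20) p
  have s2 := conj_symWeight 0 (1 / 3) (1 / 12) p
  have s3 := conj_symWeight 0 (2 / 5) (1 / 10) p
  push_cast at s0 s1 s2 s3
  have t1 := h.conj_taylorPart (k := 1) (by norm_num) p
  have t2 := h.conj_taylorPart (k := 2) (by norm_num) p
  have t3 := h.conj_taylorPart (k := 3) (by norm_num) p
  rw [lowCoeff, map_sum]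
  refine Finset.sum_congr rfl fun k _ => ?_
  rw [map_mul]
  congr 1
  · match j - k with
    | 0 => simp [gaugeCoeff]
    | 1 => simp [gaugeCoeff, t1, map_ofNat]
    | 2 => simp [gaugeCoeff, t1, t2, map_ofNat]
    | 3 => simp [gaugeCoeff, t1, t2, t3, map_ofNat]
    | _ + 4 => simp [gaugeCoeff]
  · match k with
    | 0 => exact s0
    | 1 => simp [schrodingerCoeff]
    | 2 => rw [schrodingerCoeff, map_mul, hq, s1]
    | 3 =>
      rw [schrodingerCoeff]
      simp only [map_sub, map_mul, map_add, hz, hzb, conj_monoN, s2, s3]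
      ring
    | _ + 4 => simp [schrodingerCoeff]

/-! ### Levels four to seven by prescribing moments. -/

/-- The equations of level `j` for `M = 6`, in complex form. -/
def LevelSystem (w : ℝ × ℝ → ℝ) (x : ℝ × ℝ) (c : ℤ × ℤ → ℕ → ℝ) (j : ℕ) : Prop :=
  ∀ m : ℕ, m + j ≤ 7 → ∑ k ∈ Finset.range (j + 1),
    ∑ p ∈ stencil, taylorA w x (m + (j - k)) m 0 p * (c p k : ℂ) = 0

/-- For `m = 0` every term with `k < j` drops out, so this equation is exactly the sum condition. -/
theorem sum_taylorA_zero (w : ℝ × ℝ → ℝ) (x : ℝ × ℝ) (c : ℤ × ℤ → ℕ → ℂ) (j : ℕ) :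
    ∑ k ∈ Finset.range (j + 1), ∑ p ∈ stencil, taylorA w x (0 + (j - k)) 0 0 p * c p k
      = ∑ p ∈ stencil, c p j := by
  rw [Finset.sum_range_succ, Finset.sum_eq_zero, zero_add]
  · simp [taylorA_zero_zero]
  · intro k hk
    rw [Finset.mem_range] at hk
    refine Finset.sum_eq_zero fun p _ => ?_
    rw [taylorA_zero_zero, if_neg (by omega), zero_mul]

theorem LevelSystem.sum_eq_zero {w : ℝ × ℝ → ℝ} {x : ℝ × ℝ} {c : ℤ × ℤ → ℕ → ℝ} {j : ℕ}
    (h : LevelSystem w x c j) (hj : j ≤ 7) : ∑ p ∈ stencil, c p j = 0 := by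
  have := h 0 (by omega)
  rw [sum_taylorA_zero w x (fun p k => (c p k : ℂ))] at this
  exact_mod_cast this

theorem LevelSystem.interiorSystem {w : ℝ × ℝ → ℝ} {x : ℝ × ℝ} {c : ℤ × ℤ → ℕ → ℝ} {j : ℕ}
    (h : LevelSystem w x c j) : InteriorSystem w x 6 c j := by
  have key : ∀ m, m + j ≤ 7 → ∑ p ∈ stencil, taylorA w x m m 0 p * (c p j : ℂ) =
      -∑ k ∈ Finset.range j, ∑ p ∈ stencil, taylorA w x (m + j - k) m 0 p * (c p k : ℂ) := by
    intro m hm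
    have := h m hm
    rw [Finset.sum_range_succ, Nat.sub_self, add_zero] at this
    rw [eq_neg_iff_add_eq_zero, add_comm, ← this]
    congr 1
    refine Finset.sum_congr rfl fun k hk => ?_
    rw [Finset.mem_range] at hk
    rw [Nat.add_sub_assoc hk.le]
  refine ⟨fun m hm => ?_, fun m _ hm => ?_⟩
  · simpa [Complex.re_sum] using congrArg Complex.re (key m hm)
  · simpa [Complex.im_sum] using congrArg Complex.im (key m hm)

/-- A stencil with prescribed moments of order one, two and three. -/
def momentStencil (r : ℕ → ℂ) (p : ℤ × ℤ) : ℝ :=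
  (r 1 * (monoN 0 1 p * symWeight 0 (1 / 3) (1 / 12) p)
    + r 2 * (monoN 0 2 p * symWeight 0 1 (1 / 4) p)
    + r 3 * (monoN 0 3 p * symWeight 0 6 (3 / 2) p)).re

/-- Write the real part as half the sum with the conjugate. By invariance under quarter turns, the
only pairings of monomials that survive are `z^m z̄^m` and those giving `z^4`. Edge weights four
times the corner weights make the sum of `z^4` vanish, and the scalings make each diagonal sum `∑
N^{m,0} N^{0,m}` equal to 2. The zeroth moment is always zero, whence the hypothesis on `r 0`. -/
theorem sum_monoN_mul_momentStencil {r : ℕ → ℂ} (h0 : r 0 = 0) {m : ℕ} (hm : m ≤ 3) :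
    ∑ p ∈ stencil, monoN m 0 p * (momentStencil r p : ℂ) = r m := by
  have s1 := conj_symWeight 0 (1 / 3) (1 / 12)
  have s2 := conj_symWeight 0 1 (1 / 4)
  have s3 := conj_symWeight 0 6 (3 / 2)
  push_cast at s1 s2 s3
  simp only [momentStencil, Complex.re_eq_add_conj, map_add, map_mul, conj_monoN, s1, s2, s3]
  simp only [sum_stencil, monoN, symWeight]
  interval_cases m <;> norm_num [Nat.factorial, h0] <;> ring_nf <;>
    simp only [Complex.I_sq, I_pow_three, Complex.I_pow_four, I_pow_six] <;>
    ring

/-- The right-hand side of the equations of level `J`. -/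
def levelRhs (w : ℝ × ℝ → ℝ) (x : ℝ × ℝ) (c : ℤ × ℤ → ℕ → ℝ) (J m : ℕ) : ℂ :=
  if 7 < m + J then 0
  else -∑ k ∈ Finset.range J, ∑ p ∈ stencil, taylorA w x (m + (J - k)) m 0 p * (c p k : ℂ)

/-- Solve the equations of level `J`. -/
def extendLevel (w : ℝ × ℝ → ℝ) (x : ℝ × ℝ) (J : ℕ) (c : ℤ × ℤ → ℕ → ℝ) (p : ℤ × ℤ) (j : ℕ) : ℝ :=
  if j = J then momentStencil (levelRhs w x c J) p else c p j

theorem LevelSystem.extendLevel_of_lt {w : ℝ × ℝ → ℝ} {x : ℝ × ℝ} {c : ℤ × ℤ → ℕ → ℝ} {j J : ℕ}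
    (h : LevelSystem w x c j) (hj : j < J) : LevelSystem w x (extendLevel w x J c) j := by
  intro m hm
  rw [← h m hm]
  refine Finset.sum_congr rfl fun k hk => Finset.sum_congr rfl fun p _ => ?_
  rw [Finset.mem_range] at hk
  rw [extendLevel, if_neg (by omega)]

theorem levelSystem_extendLevel (w : ℝ × ℝ → ℝ) (x : ℝ × ℝ) (c : ℤ × ℤ → ℕ → ℝ) {J : ℕ}
    (hJ : 4 ≤ J) : LevelSystem w x (extendLevel w x J c) J := by
  intro m hm
  have h0 : levelRhs w x c J 0 = 0 := by
    rw [levelRhs, if_neg (by omega), neg_eq_zero]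
    refine Finset.sum_eq_zero fun k hk => Finset.sum_eq_zero fun p _ => ?_
    rw [Finset.mem_range] at hk
    rw [taylorA_zero_zero, if_neg (by omega), zero_mul]
  rw [Finset.sum_range_succ, Nat.sub_self, add_zero]
  have h1 : ∑ p ∈ stencil, taylorA w x m m 0 p * (extendLevel w x J c p J : ℂ)
      = levelRhs w x c J m := by
    rw [← sum_monoN_mul_momentStencil h0 (show m ≤ 3 by omega)]
    refine Finset.sum_congr rfl fun p _ => ?_
    rw [taylorA_self, extendLevel, if_pos rfl]
  rw [h1, levelRhs, if_neg (by omega), ← sub_eq_add_neg, sub_eq_zero]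
  refine Finset.sum_congr rfl fun k hk => Finset.sum_congr rfl fun p _ => ?_
  rw [Finset.mem_range] at hk
  rw [extendLevel, if_neg (by omega)]

theorem JetBounded.extendLevel {c : (ℝ × ℝ → ℝ) → ℝ × ℝ → ℤ × ℤ → ℕ → ℝ}
    (h : ∀ p j, JetBounded fun w x => c w x p j) {J : ℕ} (h4 : 4 ≤ J) (hJ : J ≤ 7)
    (p : ℤ × ℤ) (j : ℕ) :
    JetBounded fun w x => extendLevel w x J (c w x) p j := by
  have hr : ∀ m, JetBounded fun w x => levelRhs w x (c w x) J m := fun m => by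
    unfold levelRhs
    -- Moments beyond the system are set to zero: their formula would involve `A^k` with `k > 7`,
    -- hence uncontrolled derivatives of `ã`.
    split_ifs with hm
    · exact const _
    · exact (sum _ fun k hk => sum _ fun q _ => (taylorA (by omega) _ _ _).mul (h q k).ofReal).neg
  unfold CompactFDM.extendLevel
  split_ifs with hj
  · exact ((((hr 1).mul (const _)).add ((hr 2).mul (const _))).add ((hr 3).mul (const _))).re
  · exact h p j

/-- A stencil solving the equations of all levels. -/
def solution (w : ℝ × ℝ → ℝ) (x : ℝ × ℝ) : ℤ × ℤ → ℕ → ℝ :=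
  extendLevel w x 7 (extendLevel w x 6 (extendLevel w x 5 (extendLevel w x 4
    fun p j => (lowCoeff w x j p).re)))

theorem jetBounded_solution (p : ℤ × ℤ) (j : ℕ) : JetBounded fun w x => solution w x p j :=
  .extendLevel (.extendLevel (.extendLevel (.extendLevel (fun p j => (JetBounded.lowCoeff j p).re)
    (by norm_num) (by norm_num)) (by norm_num) (by norm_num)) (by norm_num) (by norm_num))
    (by norm_num) (by norm_num) p j

theorem solution_zero (w : ℝ × ℝ → ℝ) (x : ℝ × ℝ) (p : ℤ × ℤ) :
    (solution w x p 0 : ℂ) = symWeight 20 (-4) (-1) p := by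
  simp only [solution, extendLevel]
  norm_num [lowCoeff, gaugeCoeff, schrodingerCoeff, symWeight]
  split_ifs <;> norm_num

theorem sum_lowCoeff (w : ℝ × ℝ → ℝ) (x : ℝ × ℝ) {j : ℕ} (hj : j ≤ 3) :
    ∑ p ∈ stencil, lowCoeff w x j p = 0 := by
  simp only [sum_stencil, monoN, lowCoeff, gaugeCoeff, schrodingerCoeff, taylorPart, potential,
    potentialDz, potentialDzbar, symWeight]
  interval_cases j <;> simp only [Finset.sum_range_succ, Finset.sum_range_zero] <;>
    norm_num [Nat.factorial] <;> ring_nf <;>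
    simp only [Complex.I_sq, I_pow_three] <;> ring

theorem lowCoeff_system (w : ℝ × ℝ → ℝ) (x : ℝ × ℝ) {j : ℕ} (hj : j ≤ 3) {m : ℕ}
    (hm : m + j ≤ 7) : ∑ k ∈ Finset.range (j + 1),
      ∑ p ∈ stencil, taylorA w x (m + (j - k)) m 0 p * lowCoeff w x k p = 0 := by
  rcases Nat.eq_zero_or_pos m with rfl | h1
  · rw [sum_taylorA_zero w x fun p k => lowCoeff w x k p]
    exact sum_lowCoeff w x hj
  · interval_cases j
    · simpa using lowCoeff_system_zero w x hm
    · exact lowCoeff_system_one w x h1 (by omega)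
    · exact lowCoeff_system_two w x h1 (by omega)
    · exact lowCoeff_system_three w x h1 (by omega)

theorem RealJet.levelSystem_solution {w : ℝ × ℝ → ℝ} {x : ℝ × ℝ} (h : RealJet w x) {j : ℕ}
    (hj : j ≤ 7) : LevelSystem w x (solution w x) j := by
  have hlow : j ≤ 3 → LevelSystem w x (fun p j => (lowCoeff w x j p).re) j := fun h3 m hm => by
    rw [← lowCoeff_system w x h3 hm]
    refine Finset.sum_congr rfl fun k _ => Finset.sum_congr rfl fun p _ => ?_
    rw [Complex.conj_eq_iff_re.1 (h.conj_lowCoeff k p)]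
  unfold solution
  by_cases h7 : j = 7
  · subst h7; exact levelSystem_extendLevel _ _ _ (by norm_num)
  refine LevelSystem.extendLevel_of_lt ?_ (by omega)
  by_cases h6 : j = 6
  · subst h6; exact levelSystem_extendLevel _ _ _ (by norm_num)
  refine LevelSystem.extendLevel_of_lt ?_ (by omega)
  by_cases h5 : j = 5
  · subst h5; exact levelSystem_extendLevel _ _ _ (by norm_num)
  refine LevelSystem.extendLevel_of_lt ?_ (by omega)
  by_cases h4 : j = 4
  · subst h4; exact levelSystem_extendLevel _ _ _ (by norm_num)
  exact LevelSystem.extendLevel_of_lt (hlow (by omega)) (by omega)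

/-! ### The sign condition by a geometric series. -/

/-- The coefficients of the product of `∑ c j h ^ j` with the geometric series of ratio `R h`. -/
def geomProduct (R : ℝ) (c : ℕ → ℝ) : ℕ → ℝ
  | 0 => c 0
  | j + 1 => c (j + 1) + R * geomProduct R c j

/-- The level-`(j + 1)` equation of the product is that of `c` plus `R` times the level-`j` equation
of the product for the same `m`, which is still within the range `m + j ≤ 7`. -/
theorem LevelSystem.geomProduct {w : ℝ × ℝ → ℝ} {x : ℝ × ℝ} {c : ℤ × ℤ → ℕ → ℝ} (R : ℝ)
    (h : ∀ j ≤ 7, LevelSystem w x c j) {j : ℕ} (hj : j ≤ 7) :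
    LevelSystem w x (fun p => CompactFDM.geomProduct R (c p)) j := by
  induction j with
  | zero => exact h 0 hj
  | succ j ih =>
    intro m hm
    have h1 := h (j + 1) hj m hm
    have h2 := ih (by omega) m (by omega)
    -- Splitting off `k = 0`, where both sequences agree, aligns the shifted remainder with level
    -- `j`.
    rw [Finset.sum_range_succ'] at h1 ⊢
    simp only [CompactFDM.geomProduct, Nat.add_sub_add_right] at h1 ⊢
    rw [← h1]
    have : ∀ k p, taylorA w x (m + (j - k)) m 0 p *
        ((c p (k + 1) + R * CompactFDM.geomProduct R (c p) k : ℝ) : ℂ) =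
        taylorA w x (m + (j - k)) m 0 p * (c p (k + 1) : ℂ) +
        R * (taylorA w x (m + (j - k)) m 0 p * (CompactFDM.geomProduct R (c p) k : ℂ)) := by
      intro k p
      push_cast
      ring
    simp only [this, Finset.sum_add_distrib, ← Finset.mul_sum]
    rw [h2]
    ring

/-- The ratio of the geometric series that enforces the sign condition. -/
def signRatio (w : ℝ × ℝ → ℝ) (x : ℝ × ℝ) : ℝ :=
  1 + ∑ p ∈ stencil, ∑ j ∈ Finset.range 8, ‖solution w x p j‖

/-- A stencil solving the equations of all levels and satisfying the sign condition. -/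
def signedSolution (w : ℝ × ℝ → ℝ) (x : ℝ × ℝ) (p : ℤ × ℤ) : ℕ → ℝ :=
  geomProduct (signRatio w x) (solution w x p)

theorem jetBounded_signedSolution (p : ℤ × ℤ) (j : ℕ) :
    JetBounded fun w x => signedSolution w x p j := by
  have hR : JetBounded signRatio :=
    (JetBounded.const _).add (.sum _ fun p _ => .sum _ fun j _ => (jetBounded_solution p j).norm)
  induction j with
  | zero => exact jetBounded_solution p 0
  | succ j ih => exact (jetBounded_solution p (j + 1)).add (hR.mul ih)

theorem RealJet.levelSystem_signedSolution {w : ℝ × ℝ → ℝ} {x : ℝ × ℝ} (h : RealJet w x) {j : ℕ}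
    (hj : j ≤ 7) : LevelSystem w x (signedSolution w x) j :=
  LevelSystem.geomProduct _ (fun _ hj => h.levelSystem_solution hj) hj

theorem abs_solution_le (w : ℝ × ℝ → ℝ) (x : ℝ × ℝ) {p : ℤ × ℤ} (hp : p ∈ stencil) {j : ℕ}
    (hj : j ≤ 7) : |solution w x p j| ≤ signRatio w x - 1 := by
  rw [signRatio, add_sub_cancel_left]
  refine (Finset.single_le_sum (f := fun j => ‖solution w x p j‖) (fun _ _ => norm_nonneg _)
    (Finset.mem_range.2 (by omega : j < 8))).trans ?_
  exact Finset.single_le_sum (f := fun p => ∑ j ∈ Finset.range 8, ‖solution w x p j‖)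
    (fun _ _ => Finset.sum_nonneg fun _ _ => norm_nonneg _) hp

theorem one_le_signRatio (w : ℝ × ℝ → ℝ) (x : ℝ × ℝ) : 1 ≤ signRatio w x := by
  have := (abs_nonneg _).trans (abs_solution_le w x (p := (0, 0)) (by decide) (Nat.zero_le 7))
  linarith

/-- If the previous coefficient is at least 1, the next is at least `-(R - 1) + R = 1`, since `R -
1` bounds every weight. The mirrored estimate serves the other nodes. -/
theorem one_le_signedSolution (w : ℝ × ℝ → ℝ) (x : ℝ × ℝ) {j : ℕ} (hj : j ≤ 7) :
    1 ≤ signedSolution w x (0, 0) j := by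
  induction j with
  | zero =>
    have h0 : solution w x (0, 0) 0 = 20 := by
      have := solution_zero w x (0, 0)
      simp only [symWeight, if_true] at this
      exact_mod_cast this
    simp only [signedSolution, geomProduct, h0]
    norm_num
  | succ j ih =>
    have h1 := neg_abs_le (solution w x (0, 0) (j + 1))
    have h2 := abs_solution_le w x (p := (0, 0)) (by decide) hj
    have h3 := mul_le_mul_of_nonneg_left (ih (by omega))
      (zero_le_one.trans (one_le_signRatio w x))
    change 1 ≤ _ + signRatio w x * signedSolution w x (0, 0) j
    linarith

theorem signedSolution_le (w : ℝ × ℝ → ℝ) (x : ℝ × ℝ) {p : ℤ × ℤ} (hp : p ∈ stencil)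
    (h0 : p ≠ (0, 0)) {j : ℕ} (hj : j ≤ 7) : signedSolution w x p j ≤ -1 := by
  induction j with
  | zero =>
    have := solution_zero w x p
    rw [symWeight, if_neg h0] at this
    change solution w x p 0 ≤ -1
    split_ifs at this
    · have : solution w x p 0 = -4 := by exact_mod_cast this
      linarith
    · have : solution w x p 0 = -1 := by exact_mod_cast this
      linarith
  | succ j ih =>
    have h1 := le_abs_self (solution w x p (j + 1))
    have h2 := abs_solution_le w x hp hj
    have h3 := mul_le_mul_of_nonneg_left (ih (by omega))
      (zero_le_one.trans (one_le_signRatio w x))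
    change _ + signRatio w x * signedSolution w x p j ≤ -1
    linarith

/-! ### Solvability of the leading-order system. -/

theorem interiorSystem_zero (w : ℝ × ℝ → ℝ) (x : ℝ × ℝ) {M : ℕ} (hM : M ≤ 6) :
    InteriorSystem w x M (solution w x) 0 := by
  have key : ∀ m, m ≤ 7 → ∑ p ∈ stencil, taylorA w x m m 0 p * (solution w x p 0 : ℂ) = 0 := by
    intro m hm
    rw [← lowCoeff_system_zero w x hm]
    refine Finset.sum_congr rfl fun p _ => ?_
    rw [solution_zero]
    simp [lowCoeff, gaugeCoeff, schrodingerCoeff]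
  refine ⟨fun m hm => ?_, fun m _ hm => ?_⟩
  · simpa [Complex.re_sum] using congrArg Complex.re (key m (by omega))
  · simpa [Complex.im_sum] using congrArg Complex.im (key m (by omega))

/-- The equations with `m ≤ 8` form a square Vandermonde system at nine distinct complex nodes. -/
theorem eq_zero_of_interiorSystem (w : ℝ × ℝ → ℝ) (x : ℝ × ℝ) {M : ℕ} (hM : 7 ≤ M)
    {c : ℤ × ℤ → ℕ → ℝ} (h : InteriorSystem w x M c 0) {p : ℤ × ℤ} (hp : p ∈ stencil) :
    c p 0 = 0 := by
  have hsum : ∀ m ≤ 8, ∑ q ∈ stencil, (c q 0 : ℂ) * ((q.1 : ℂ) + Complex.I * q.2) ^ m = 0 := by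
    intro m hm
    have key : ∑ q ∈ stencil, taylorA w x m m 0 q * (c q 0 : ℂ) = 0 := by
      apply Complex.ext
      · simpa [Complex.re_sum] using h.1 m (by omega)
      -- The system has no imaginary equation for `m = 0`; it holds trivially because the
      -- coefficient is 1.
      · rcases Nat.eq_zero_or_pos m with rfl | hm0
        · simp [Complex.im_sum, taylorA_zero_zero]
        · simpa [Complex.im_sum] using h.2 m hm0 (by omega)
    have h2 : (m.factorial : ℂ) ≠ 0 := by exact_mod_cast m.factorial_ne_zero
    rw [← mul_zero (m.factorial : ℂ), ← key, Finset.mul_sum]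
    refine Finset.sum_congr rfl fun q _ => ?_
    rw [taylorA_self, monoN]
    simp
    field_simp
  let e : Fin 9 ≃ stencil := (stencil.equivFinOfCardEq (by decide)).symm
  have hinj : Function.Injective fun i => ((e i).1.1 : ℂ) + Complex.I * ((e i).1.2 : ℂ) := by
    intro i j hij
    apply e.injective
    apply Subtype.ext
    have h1 := congrArg Complex.re hij
    have h2 := congrArg Complex.im hij
    simp at h1 h2
    exact Prod.ext h1 h2
  have := Matrix.eq_zero_of_forall_pow_sum_mul_pow_eq_zero (v := fun i => (c (e i).1 0 : ℂ)) hinj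
    fun m => by
      rw [← hsum m (by omega), ← Finset.sum_coe_sort stencil]
      exact e.sum_comp fun q : stencil =>
        (c q.1 0 : ℂ) * ((q.1.1 : ℂ) + Complex.I * (q.1.2 : ℂ)) ^ (m : ℕ)
  have h3 := congrFun this (e.symm ⟨p, hp⟩)
  simpa using h3

theorem exists_interiorSystem_iff (w : ℝ × ℝ → ℝ) (x : ℝ × ℝ) (M : ℕ) :
    (∃ c : ℤ × ℤ → ℕ → ℝ, InteriorSystem w x M c 0 ∧ ∃ p ∈ stencil, c p 0 ≠ 0) ↔ M ≤ 6 := by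
  refine ⟨?_, fun hM => ⟨_, interiorSystem_zero w x hM, (0, 0), by decide, ?_⟩⟩
  · rintro ⟨c, hc, p, hp, h0⟩
    by_contra hM
    exact h0 (eq_zero_of_interiorSystem w x (by omega) hc hp)
  · have := solution_zero w x (0, 0)
    intro h
    rw [h] at this
    norm_num [symWeight] at this

/-! ### Calculus of constant-coefficient first-order operators. -/

/-- The first-order operator `c ∂/∂x + d ∂/∂y`. -/
def dop (c d : ℂ) (v : ℝ × ℝ → ℂ) : ℝ × ℝ → ℂ :=
  fun y => c * dx v y + d * dy v y

theorem dz_eq_dop : dz = dop (1 / 2) (-(Complex.I / 2)) := by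
  funext v y
  simp only [dz, dop]
  ring

theorem dzbar_eq_dop : dzbar = dop (1 / 2) (Complex.I / 2) := by
  funext v y
  simp only [dzbar, dop]
  ring

theorem dx_eq_dop : (dx : (ℝ × ℝ → ℂ) → ℝ × ℝ → ℂ) = dop 1 0 := by
  funext v y
  simp [dop]

theorem dy_eq_dop : (dy : (ℝ × ℝ → ℂ) → ℝ × ℝ → ℂ) = dop 0 1 := by
  funext v y
  simp [dop]

theorem dop_add {c d : ℂ} {f g : ℝ × ℝ → ℂ} {y : ℝ × ℝ} (hf : DifferentiableAt ℝ f y)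
    (hg : DifferentiableAt ℝ g y) :
    dop c d (fun t => f t + g t) y = dop c d f y + dop c d g y := by
  simp only [dop, dx, dy, fderiv_fun_add hf hg, add_apply]
  ring

theorem dop_const_mul {c d : ℂ} {f : ℝ × ℝ → ℂ} {y : ℝ × ℝ} (hf : DifferentiableAt ℝ f y) (r : ℂ) :
    dop c d (fun t => r * f t) y = r * dop c d f y := by
  simp only [dop, dx, dy, fderiv_const_mul hf, smul_apply, smul_eq_mul]
  ring

theorem dop_mul {c d : ℂ} {f g : ℝ × ℝ → ℂ} {y : ℝ × ℝ} (hf : DifferentiableAt ℝ f y)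
    (hg : DifferentiableAt ℝ g y) :
    dop c d (fun t => f t * g t) y = f y * dop c d g y + dop c d f y * g y := by
  simp only [dop, dx, dy, fderiv_fun_mul hf hg, add_apply,
    smul_apply, smul_eq_mul]
  ring

theorem dop_sum {c d : ℂ} {ι : Type*} (s : Finset ι) {f : ι → ℝ × ℝ → ℂ} {y : ℝ × ℝ}
    (hf : ∀ i ∈ s, DifferentiableAt ℝ (f i) y) :
    dop c d (fun t => ∑ i ∈ s, f i t) y = ∑ i ∈ s, dop c d (f i) y := by
  simp only [dop, dx, dy, fderiv_fun_sum hf, sum_apply, Finset.mul_sum,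
    Finset.sum_add_distrib]

theorem contDiffOn_dop {Ω : Set (ℝ × ℝ)} (hΩ : IsOpen Ω) {c d : ℂ} {v : ℝ × ℝ → ℂ} {n : ℕ}
    (hv : ContDiffOn ℝ (n + 1 : ℕ) v Ω) : ContDiffOn ℝ n (dop c d v) Ω := by
  have h : ContDiffOn ℝ n (fderiv ℝ v) Ω := hv.fderiv_of_isOpen hΩ (by norm_cast)
  exact (contDiffOn_const.mul (h.clm_apply contDiffOn_const)).add
    (contDiffOn_const.mul (h.clm_apply contDiffOn_const))

theorem contDiffOn_iterate_dop {Ω : Set (ℝ × ℝ)} (hΩ : IsOpen Ω) {c d : ℂ} {v : ℝ × ℝ → ℂ}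
    {n : ℕ} (k : ℕ) (hv : ContDiffOn ℝ (n + k : ℕ) v Ω) : ContDiffOn ℝ n ((dop c d)^[k] v) Ω := by
  induction k generalizing v with
  | zero => exact hv
  | succ k ih => exact ih (contDiffOn_dop hΩ hv)

theorem differentiableAt_of_contDiffOn {E : Type*} [NormedAddCommGroup E] [NormedSpace ℝ E]
    {Ω : Set (ℝ × ℝ)} (hΩ : IsOpen Ω) {v : ℝ × ℝ → E} {n : ℕ}
    (hv : ContDiffOn ℝ (n + 1 : ℕ) v Ω) {y : ℝ × ℝ} (hy : y ∈ Ω) : DifferentiableAt ℝ v y :=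
  (hv.contDiffAt (hΩ.mem_nhds hy)).differentiableAt (by norm_cast)

theorem differentiableAt_iterate_dop {Ω : Set (ℝ × ℝ)} (hΩ : IsOpen Ω) {c d : ℂ} {v : ℝ × ℝ → ℂ}
    {n k : ℕ} (hk : k < n) (hv : ContDiffOn ℝ n v Ω) {y : ℝ × ℝ} (hy : y ∈ Ω) :
    DifferentiableAt ℝ ((dop c d)^[k] v) y :=
  differentiableAt_of_contDiffOn (n := 0) hΩ
    (contDiffOn_iterate_dop hΩ k (hv.of_le (by exact_mod_cast (by omega)))) hy

theorem eqOn_fderiv {E : Type*} [NormedAddCommGroup E] [NormedSpace ℝ E] {Ω : Set (ℝ × ℝ)}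
    (hΩ : IsOpen Ω) {v v' : ℝ × ℝ → E} (h : Set.EqOn v v' Ω) {y : ℝ × ℝ} (hy : y ∈ Ω) :
    fderiv ℝ v y = fderiv ℝ v' y :=
  (Filter.eventuallyEq_of_mem (hΩ.mem_nhds hy) h).fderiv_eq

theorem dop_congr {Ω : Set (ℝ × ℝ)} (hΩ : IsOpen Ω) {c d : ℂ} {v v' : ℝ × ℝ → ℂ}
    (h : Set.EqOn v v' Ω) : Set.EqOn (dop c d v) (dop c d v') Ω := fun y hy => by
  simp only [dop, dx, dy, eqOn_fderiv hΩ h hy]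

theorem iterate_dop_congr {Ω : Set (ℝ × ℝ)} (hΩ : IsOpen Ω) {c d : ℂ} {v v' : ℝ × ℝ → ℂ} (k : ℕ)
    (h : Set.EqOn v v' Ω) : Set.EqOn ((dop c d)^[k] v) ((dop c d)^[k] v') Ω := by
  induction k generalizing v v' with
  | zero => exact h
  | succ k ih => exact ih (dop_congr hΩ h)

theorem dx_dy_comm {Ω : Set (ℝ × ℝ)} (hΩ : IsOpen Ω) {v : ℝ × ℝ → ℂ}
    (hv : ContDiffOn ℝ 2 v Ω) {y : ℝ × ℝ} (hy : y ∈ Ω) : dx (dy v) y = dy (dx v) y := by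
  have h2 := hv.contDiffAt (hΩ.mem_nhds hy)
  have hd : DifferentiableAt ℝ (fderiv ℝ v) y :=
    (h2.fderiv_right (m := 1) (by norm_num)).differentiableAt (by norm_num)
  have hs := h2.isSymmSndFDerivAt (by simp)
  have e : ∀ a b : ℝ × ℝ, fderiv ℝ (fun t => fderiv ℝ v t a) y b = fderiv ℝ (fderiv ℝ v) y b a := by
    intro a b
    rw [fderiv_clm_apply hd (differentiableAt_const _)]
    simp
  change fderiv ℝ (fun t => fderiv ℝ v t (0, 1)) y (1, 0)
    = fderiv ℝ (fun t => fderiv ℝ v t (1, 0)) y (0, 1)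
  rw [e, e, hs]

/-- This reduces to the symmetry of the second derivative. One family of operators covers `∂`, `∂̄`,
the partial derivatives and the derivative along a segment. -/
theorem dop_comm {Ω : Set (ℝ × ℝ)} (hΩ : IsOpen Ω) {c d c' d' : ℂ} {v : ℝ × ℝ → ℂ}
    (hv : ContDiffOn ℝ 2 v Ω) : Set.EqOn (dop c d (dop c' d' v)) (dop c' d' (dop c d v)) Ω := by
  intro y hy
  have hx : DifferentiableAt ℝ (dx v) y := by
    rw [dx_eq_dop]
    exact differentiableAt_iterate_dop hΩ (k := 1) (n := 2) (by norm_num) hv hy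
  have hy' : DifferentiableAt ℝ (dy v) y := by
    rw [dy_eq_dop]
    exact differentiableAt_iterate_dop hΩ (k := 1) (n := 2) (by norm_num) hv hy
  have key : ∀ a b a' b' : ℂ, dop a b (dop a' b' v) y = a' * (a * dx (dx v) y + b * dy (dx v) y)
      + b' * (a * dx (dy v) y + b * dy (dy v) y) := by
    intro a b a' b'
    change dop a b (fun t => a' * dx v t + b' * dy v t) y = _
    rw [dop_add (hx.const_mul _) (hy'.const_mul _), dop_const_mul hx, dop_const_mul hy']
    rfl
  rw [key, key, dx_dy_comm hΩ hv hy]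
  ring

theorem iterate_dop_dop_comm {Ω : Set (ℝ × ℝ)} (hΩ : IsOpen Ω) {c d c' d' : ℂ} {v : ℝ × ℝ → ℂ}
    (n : ℕ) (hv : ContDiffOn ℝ (n + 1 : ℕ) v Ω) :
    Set.EqOn ((dop c d)^[n] (dop c' d' v)) (dop c' d' ((dop c d)^[n] v)) Ω := by
  induction n generalizing v with
  | zero => exact fun _ _ => rfl
  | succ n ih =>
    have h2 : ContDiffOn ℝ 2 v Ω := hv.of_le (by exact_mod_cast (by omega))
    exact (iterate_dop_congr hΩ n (dop_comm hΩ h2)).trans (ih (contDiffOn_dop hΩ hv))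

theorem iterate_dop_comm {Ω : Set (ℝ × ℝ)} (hΩ : IsOpen Ω) {c d c' d' : ℂ} {v : ℝ × ℝ → ℂ}
    (n k : ℕ) (hv : ContDiffOn ℝ (n + k : ℕ) v Ω) :
    Set.EqOn ((dop c d)^[n] ((dop c' d')^[k] v)) ((dop c' d')^[k] ((dop c d)^[n] v)) Ω := by
  induction k generalizing v with
  | zero => exact fun _ _ => rfl
  | succ k ih =>
    exact (ih (contDiffOn_dop hΩ hv)).trans (iterate_dop_congr hΩ k
      (iterate_dop_dop_comm hΩ n (hv.of_le (by exact_mod_cast (by omega)))))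

theorem iterate_dop_mul {Ω : Set (ℝ × ℝ)} (hΩ : IsOpen Ω) {c d : ℂ} {f g : ℝ × ℝ → ℂ} (n : ℕ)
    (hf : ContDiffOn ℝ n f Ω) (hg : ContDiffOn ℝ n g Ω) :
    Set.EqOn ((dop c d)^[n] fun t => f t * g t) (fun t => ∑ i ∈ Finset.range (n + 1),
      (n.choose i : ℂ) * ((dop c d)^[i] f t * (dop c d)^[n - i] g t)) Ω := by
  induction n with
  | zero => intro y _; simp
  | succ n ih =>
    intro y hy
    have hf' : ∀ i < n + 1, DifferentiableAt ℝ ((dop c d)^[i] f) y := fun i hi =>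
      differentiableAt_iterate_dop hΩ hi hf hy
    have hg' : ∀ i < n + 1, DifferentiableAt ℝ ((dop c d)^[i] g) y := fun i hi =>
      differentiableAt_iterate_dop hΩ hi hg hy
    rw [Function.iterate_succ_apply', dop_congr hΩ (ih (hf.of_le (by exact_mod_cast (by omega)))
      (hg.of_le (by exact_mod_cast (by omega)))) hy, dop_sum]
    · simp only
      rw [Finset.sum_choose_succ_mul (fun i j => (dop c d)^[i] f y * (dop c d)^[j] g y),
        ← Finset.sum_add_distrib]
      refine Finset.sum_congr rfl fun i hi => ?_
      rw [Finset.mem_range] at hi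
      rw [dop_const_mul ((hf' _ (by omega)).fun_mul (hg' _ (by omega))),
        dop_mul (hf' _ (by omega)) (hg' _ (by omega)), show n + 1 - i = n - i + 1 by omega,
        Function.iterate_succ_apply', Function.iterate_succ_apply']
      ring
    · intro i hi
      rw [Finset.mem_range] at hi
      exact ((hf' _ (by omega)).fun_mul (hg' _ (by omega))).const_mul _

theorem iterate_dop_sum {Ω : Set (ℝ × ℝ)} (hΩ : IsOpen Ω) {c d : ℂ} {ι : Type*} (s : Finset ι)
    {a : ι → ℂ} {f : ι → ℝ × ℝ → ℂ} (n : ℕ) (hf : ∀ i ∈ s, ContDiffOn ℝ n (f i) Ω) :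
    Set.EqOn ((dop c d)^[n] fun t => ∑ i ∈ s, a i * f i t)
      (fun t => ∑ i ∈ s, a i * (dop c d)^[n] (f i) t) Ω := by
  induction n with
  | zero => exact fun _ _ => rfl
  | succ n ih =>
    intro y hy
    have hf' : ∀ i ∈ s, DifferentiableAt ℝ ((dop c d)^[n] (f i)) y := fun i hi =>
      differentiableAt_iterate_dop hΩ (Nat.lt_succ_self n) (hf i hi) hy
    rw [Function.iterate_succ_apply', dop_congr hΩ (ih fun i hi => (hf i hi).of_le
      (by exact_mod_cast (by omega))) hy, dop_sum _ fun i hi => (hf' i hi).const_mul _]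
    refine Finset.sum_congr rfl fun i hi => ?_
    rw [dop_const_mul (hf' i hi), Function.iterate_succ_apply']

/-- The Leibniz rule for a product of powers of two commuting first-order operators. -/
theorem iterate_dop_iterate_dop_mul {Ω : Set (ℝ × ℝ)} (hΩ : IsOpen Ω) {c d c' d' : ℂ}
    {f g : ℝ × ℝ → ℂ} (k l : ℕ) (hf : ContDiffOn ℝ (k + l : ℕ) f Ω)
    (hg : ContDiffOn ℝ (k + l : ℕ) g Ω) :
    Set.EqOn ((dop c d)^[k] ((dop c' d')^[l] fun t => f t * g t))
      (fun t => ∑ j ∈ Finset.range (l + 1), ∑ i ∈ Finset.range (k + 1),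
        (k.choose i : ℂ) * (l.choose j : ℂ) * ((dop c d)^[i] ((dop c' d')^[j] f) t *
          (dop c d)^[k - i] ((dop c' d')^[l - j] g) t)) Ω := by
  have hf' : ∀ j ≤ l, ContDiffOn ℝ k ((dop c' d')^[j] f) Ω := fun j hj =>
    contDiffOn_iterate_dop hΩ j (hf.of_le (by exact_mod_cast (by omega)))
  have hg' : ∀ j ≤ l, ContDiffOn ℝ k ((dop c' d')^[j] g) Ω := fun j hj =>
    contDiffOn_iterate_dop hΩ j (hg.of_le (by exact_mod_cast (by omega)))
  intro y hy
  rw [iterate_dop_congr hΩ k (iterate_dop_mul hΩ l (hf.of_le (by exact_mod_cast (by omega)))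
    (hg.of_le (by exact_mod_cast (by omega)))) hy, iterate_dop_sum hΩ _ k _ hy]
  · refine Finset.sum_congr rfl fun j hj => ?_
    rw [Finset.mem_range] at hj
    rw [iterate_dop_mul hΩ k (hf' j (by omega)) (hg' _ (by omega)) hy, Finset.mul_sum]
    refine Finset.sum_congr rfl fun i _ => ?_
    ring
  · intro j hj
    rw [Finset.mem_range] at hj
    exact (hf' j (by omega)).mul (hg' _ (by omega))

/-- The binomial formula for two commuting first-order operators. -/
theorem iterate_dop_binomial {Ω : Set (ℝ × ℝ)} (hΩ : IsOpen Ω) {c d c' d' : ℂ} (a b : ℂ)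
    {v : ℝ × ℝ → ℂ} (n : ℕ) (hv : ContDiffOn ℝ n v Ω) :
    Set.EqOn ((dop (a * c + b * c') (a * d + b * d'))^[n] v)
      (fun t => ∑ i ∈ Finset.range (n + 1), (n.choose i : ℂ) *
        (a ^ i * b ^ (n - i) * (dop c d)^[i] ((dop c' d')^[n - i] v) t)) Ω := by
  induction n with
  | zero => intro y _; simp
  | succ n ih =>
    intro y hy
    have hd : ∀ i ∈ Finset.range (n + 1),
        DifferentiableAt ℝ ((dop c d)^[i] ((dop c' d')^[n - i] v)) y := fun i hi => by
      rw [Finset.mem_range] at hi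
      exact differentiableAt_iterate_dop hΩ (n := i + 1) (by omega) (contDiffOn_iterate_dop hΩ _
        (hv.of_le (by exact_mod_cast (by omega)))) hy
    rw [Function.iterate_succ_apply', dop_congr hΩ (ih (hv.of_le (by exact_mod_cast (by omega)))) hy,
      dop_sum _ fun i hi => ((hd i hi).const_mul _).const_mul _]
    simp only
    rw [Finset.sum_choose_succ_mul
      (fun i j => a ^ i * b ^ j * (dop c d)^[i] ((dop c' d')^[j] v) y), ← Finset.sum_add_distrib]
    refine Finset.sum_congr rfl fun i hi => ?_
    have hi' := Finset.mem_range.1 hi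
    have hcomm : (dop c d)^[i] ((dop c' d')^[n + 1 - i] v) y =
        dop c' d' ((dop c d)^[i] ((dop c' d')^[n - i] v)) y := by
      rw [show n + 1 - i = n - i + 1 by omega, Function.iterate_succ_apply']
      exact iterate_dop_dop_comm hΩ i (contDiffOn_iterate_dop hΩ _
        (hv.of_le (by exact_mod_cast (by omega)))) hy
    rw [dop_const_mul ((hd i hi).const_mul _), dop_const_mul (hd i hi), hcomm,
      Function.iterate_succ_apply', show n + 1 - i = n - i + 1 by omega]
    simp only [dop]
    ring

theorem fderiv_ofReal (v : ℝ × ℝ → ℝ) (y : ℝ × ℝ) :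
    fderiv ℝ (fun t => (v t : ℂ)) y = Complex.ofRealCLM.comp (fderiv ℝ v y) := by
  by_cases h : DifferentiableAt ℝ v y
  · exact (Complex.ofRealCLM.hasFDerivAt.comp y h.hasFDerivAt).fderiv
  · rw [fderiv_zero_of_not_differentiableAt h, fderiv_zero_of_not_differentiableAt,
      ContinuousLinearMap.comp_zero]
    intro h'
    exact h (Complex.reCLM.differentiableAt.comp y h')

theorem dx_ofReal (v : ℝ × ℝ → ℝ) : dx (fun t => (v t : ℂ)) = fun t => ((dx v t : ℝ) : ℂ) := by
  funext y
  simp [dx, fderiv_ofReal]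

theorem dy_ofReal (v : ℝ × ℝ → ℝ) : dy (fun t => (v t : ℂ)) = fun t => ((dy v t : ℝ) : ℂ) := by
  funext y
  simp [dy, fderiv_ofReal]

theorem pderiv_ofReal (i j : ℕ) (v : ℝ × ℝ → ℝ) :
    dx^[i] (dy^[j] fun t => (v t : ℂ)) = fun t => (pderiv i j v t : ℂ) := by
  have hy : ∀ v : ℝ × ℝ → ℝ, (dy^[j] fun t => (v t : ℂ)) = fun t => ((dy^[j] v) t : ℂ) := by
    induction j with
    | zero => exact fun _ => rfl
    | succ j ih => exact fun v => by rw [Function.iterate_succ_apply, dy_ofReal, ih]; rfl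
  have hx : ∀ v : ℝ × ℝ → ℝ, (dx^[i] fun t => (v t : ℂ)) = fun t => ((dx^[i] v) t : ℂ) := by
    induction i with
    | zero => exact fun _ => rfl
    | succ i ih => exact fun v => by rw [Function.iterate_succ_apply, dx_ofReal, ih]; rfl
  rw [hy, hx, pderiv]

theorem contDiffOn_ofReal {Ω : Set (ℝ × ℝ)} {n : ℕ} {v : ℝ × ℝ → ℝ} (h : ContDiffOn ℝ n v Ω) :
    ContDiffOn ℝ n (fun t => (v t : ℂ)) Ω :=
  Complex.ofRealCLM.contDiff.comp_contDiffOn h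

theorem conj_dop (c d : ℂ) (v : ℝ × ℝ → ℂ) :
    (fun t => conj (dop c d v t)) = dop (conj c) (conj d) fun t => conj (v t) := by
  funext y
  have h : fderiv ℝ (fun t => conj (v t)) y
      = (Complex.conjCLE : ℂ →L[ℝ] ℂ).comp (fderiv ℝ v y) := Complex.conjCLE.comp_fderiv
  simp [dop, dx, dy, h]

theorem conj_iterate_dop (c d : ℂ) (n : ℕ) (v : ℝ × ℝ → ℂ) :
    (fun t => conj ((dop c d)^[n] v t)) = (dop (conj c) (conj d))^[n] fun t => conj (v t) := by
  induction n generalizing v with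
  | zero => rfl
  | succ n ih => rw [Function.iterate_succ_apply, ih, conj_dop]; rfl

/-- Conjugation exchanges `∂` and `∂̄` on a real function; commutation restores the order. -/
theorem conj_cderiv {Ω : Set (ℝ × ℝ)} (hΩ : IsOpen Ω) {k l : ℕ} {v : ℝ × ℝ → ℝ}
    (hv : ContDiffOn ℝ (k + l : ℕ) v Ω) {y : ℝ × ℝ} (hy : y ∈ Ω) :
    conj (cderiv k l v y) = cderiv l k v y := by
  have h := congrFun (conj_iterate_dop (1 / 2) (-(Complex.I / 2)) k
    ((dop (1 / 2) (Complex.I / 2))^[l] fun t => (v t : ℂ))) y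
  simp only [conj_iterate_dop] at h
  rw [cderiv, dz_eq_dop, dzbar_eq_dop, h, cderiv, dz_eq_dop, dzbar_eq_dop]
  simp only [map_neg, map_div₀, map_one, map_ofNat, Complex.conj_I, Complex.conj_ofReal]
  rw [neg_div, neg_neg]
  exact iterate_dop_comm hΩ k l (contDiffOn_ofReal hv) hy

theorem dx_dy_iterate_dop {Ω : Set (ℝ × ℝ)} (hΩ : IsOpen Ω) (c d : ℂ) {v : ℝ × ℝ → ℂ} (i j : ℕ)
    (hv : ContDiffOn ℝ (i + j + 1 : ℕ) v Ω) {y : ℝ × ℝ} (hy : y ∈ Ω) :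
    dx^[i] (dy^[j] (dop c d v)) y = c * dx^[i + 1] (dy^[j] v) y + d * dx^[i] (dy^[j + 1] v) y := by
  have h1 : dx^[i] (dy^[j] (dop c d v)) y = dop c d (dx^[i] (dy^[j] v)) y := by
    rw [dx_eq_dop, dy_eq_dop, iterate_dop_congr hΩ i (iterate_dop_dop_comm hΩ j
      (hv.of_le (by exact_mod_cast (by omega)))) hy]
    exact iterate_dop_dop_comm hΩ i (contDiffOn_iterate_dop hΩ j
      (hv.of_le (by exact_mod_cast (by omega)))) hy
  have h2 : dx^[i] (dy^[j + 1] v) y = dy (dx^[i] (dy^[j] v)) y := by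
    rw [Function.iterate_succ_apply', dx_eq_dop, dy_eq_dop]
    exact iterate_dop_dop_comm hΩ i (contDiffOn_iterate_dop hΩ j
      (hv.of_le (by exact_mod_cast (by omega)))) hy
  rw [h1, h2, Function.iterate_succ_apply']
  rfl

/-- Both coefficients have modulus 1/2, so each application averages two derivatives of the next
order and the bound `K` passes through unchanged. Keeping `m` further derivatives allows a second
use, for the conjugate operator. -/
theorem norm_iterate_dop_le {Ω : Set (ℝ × ℝ)} (hΩ : IsOpen Ω) {c d : ℂ} (hc : ‖c‖ = 1 / 2)
    (hd : ‖d‖ = 1 / 2) {K : ℝ} {y : ℝ × ℝ} (hy : y ∈ Ω) (m n : ℕ) {v : ℝ × ℝ → ℂ}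
    (hv : ContDiffOn ℝ (m + n : ℕ) v Ω)
    (hK : ∀ i j, i + j = m + n → ‖dx^[i] (dy^[j] v) y‖ ≤ K) :
    ∀ i j, i + j = m → ‖dx^[i] (dy^[j] ((dop c d)^[n] v)) y‖ ≤ K := by
  induction n generalizing v with
  | zero => exact hK
  | succ n ih =>
    refine ih (contDiffOn_dop hΩ hv) fun i j hij => ?_
    rw [dx_dy_iterate_dop hΩ c d i j (hv.of_le (by exact_mod_cast (by omega))) hy]
    refine (norm_add_le _ _).trans ?_
    rw [norm_mul, norm_mul, hc, hd]
    have h1 := hK (i + 1) j (by omega)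
    have h2 := hK i (j + 1) (by omega)
    linarith

theorem norm_cderiv_le {Ω : Set (ℝ × ℝ)} (hΩ : IsOpen Ω) {n : ℕ} {v : ℝ × ℝ → ℝ}
    (hv : ContDiffOn ℝ n v Ω) {K : ℝ} {y : ℝ × ℝ} (hy : y ∈ Ω) (hK : JetBound v n K y) {k l : ℕ}
    (hkl : k + l ≤ n) : ‖cderiv k l v y‖ ≤ K := by
  have hv' := contDiffOn_ofReal (hv.of_le
    (show ((k + l : ℕ) : WithTop ℕ∞) ≤ n by exact_mod_cast hkl))
  have h := norm_iterate_dop_le hΩ (c := 1 / 2) (d := Complex.I / 2) (by norm_num) (by norm_num) hy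
    k l hv' fun i j hij => by
      rw [pderiv_ofReal]
      simpa using hK i j (by omega)
  rw [cderiv, dz_eq_dop, dzbar_eq_dop]
  exact norm_iterate_dop_le hΩ (by norm_num) (by norm_num) hy 0 k
    (contDiffOn_iterate_dop hΩ l (hv'.of_le (by exact_mod_cast (by omega))))
    (fun i j hij => h i j (by omega)) 0 0 rfl

/-! ### Reducing the derivatives of a solution to the pure ones. -/

theorem contDiffOn_aTilde {Ω : Set (ℝ × ℝ)} {a : ℝ × ℝ → ℝ} (ha : IsDiffusion Ω a) :
    ContDiffOn ℝ (6 : ℕ) (aTilde a) Ω :=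
  (ContDiffOn.log ha.contDiffOn fun x hx => (ha.pos x hx).ne').neg

theorem fTilde_eq {Ω : Set (ℝ × ℝ)} {a f u : ℝ × ℝ → ℝ} (ha : IsDiffusion Ω a)
    (hu : ContDiffOn ℝ 8 u Ω) (h : SolvesPDE Ω a f u) {y : ℝ × ℝ} (hy : y ∈ Ω) :
    fTilde a f y = dx (dx u) y + dy (dy u) y
      - (dx (aTilde a) y * dx u y + dy (aTilde a) y * dy u y) := by
  have h0 := ha.pos y hy
  have hda : DifferentiableAt ℝ a y :=
    (ha.contDiffOn.contDiffAt (ha.isOpen.mem_nhds hy)).differentiableAt (by norm_num)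
  have hdu : DifferentiableAt ℝ (fderiv ℝ u) y :=
    ((hu.contDiffAt (ha.isOpen.mem_nhds hy)).fderiv_right (m := 1) (by norm_num)).differentiableAt
      (by norm_num)
  have hd : ∀ e, DifferentiableAt ℝ (fun t => fderiv ℝ u t e) y := fun e =>
    hdu.clm_apply (differentiableAt_const e)
  have hw : fderiv ℝ (aTilde a) y = -((a y)⁻¹ • fderiv ℝ a y) :=
    (hda.hasFDerivAt.log h0.ne').neg.fderiv
  have hp : ∀ e, fderiv ℝ (fun t => a t * fderiv ℝ u t e) y
      = a y • fderiv ℝ (fun t => fderiv ℝ u t e) y + fderiv ℝ u y e • fderiv ℝ a y := fun e =>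
    fderiv_fun_mul hda (hd e)
  rw [fTilde, ← h y hy]
  unfold dx dy
  simp only [hp, hw]
  simp
  field_simp
  ring

/-- This is `Δu - ∇ã · ∇u = f̃` in complex form: `Δ = 4 ∂∂̄` and `∇ã · ∇u = 2 (∂ã ∂̄u + ∂̄ã ∂u)`. -/
theorem dz_dzbar_eq {Ω : Set (ℝ × ℝ)} {a f u : ℝ × ℝ → ℝ} (ha : IsDiffusion Ω a)
    (hu : ContDiffOn ℝ 8 u Ω) (h : SolvesPDE Ω a f u) {y : ℝ × ℝ} (hy : y ∈ Ω) :
    dz (dzbar fun t => (u t : ℂ)) y =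
      1 / 2 * (dz (fun t => (aTilde a t : ℂ)) y * dzbar (fun t => (u t : ℂ)) y
        + dzbar (fun t => (aTilde a t : ℂ)) y * dz (fun t => (u t : ℂ)) y)
      + 1 / 4 * (fTilde a f y : ℂ) := by
  have hu2 : ContDiffOn ℝ (2 : ℕ) (fun t => (u t : ℂ)) Ω :=
    contDiffOn_ofReal (hu.of_le (by norm_cast))
  have hxd : DifferentiableAt ℝ (dx fun t => (u t : ℂ)) y := by
    rw [dx_eq_dop]
    exact differentiableAt_iterate_dop ha.isOpen (k := 1) (n := 2) (by norm_num) hu2 hy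
  have hyd : DifferentiableAt ℝ (dy fun t => (u t : ℂ)) y := by
    rw [dy_eq_dop]
    exact differentiableAt_iterate_dop ha.isOpen (k := 1) (n := 2) (by norm_num) hu2 hy
  have hcomm := dx_dy_comm ha.isOpen hu2 hy
  have h1 : dz (dzbar fun t => (u t : ℂ)) y =
      1 / 4 * (dx (dx fun t => (u t : ℂ)) y + dy (dy fun t => (u t : ℂ)) y) := by
    rw [dz_eq_dop, dzbar_eq_dop]
    change dop _ _ (fun t => 1 / 2 * dx (fun t => (u t : ℂ)) t
      + Complex.I / 2 * dy (fun t => (u t : ℂ)) t) y = _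
    rw [dop_add (hxd.const_mul _) (hyd.const_mul _), dop_const_mul hxd, dop_const_mul hyd]
    simp only [dop, hcomm]
    linear_combination (-1 / 4 * dy (dy fun t => (u t : ℂ)) y) * Complex.I_sq
  rw [h1, fTilde_eq ha hu h hy]
  simp only [dz, dzbar, dx_ofReal, dy_ofReal]
  push_cast
  linear_combination (1 / 4 * ((dy (aTilde a) y : ℝ) : ℂ) * ((dy u y : ℝ) : ℂ)) * Complex.I_sq

/-- This rests on `C(n, i) = (1 - i/(n+1)) C(n+1, i)`; the added term `i = n + 1` has weight zero.
-/
theorem sum_choose_mul_succ_left (F : ℕ → ℕ → ℂ) (n : ℕ) :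
    ∑ i ∈ Finset.range (n + 1), (n.choose i : ℂ) * F (i + 1) (n - i) =
      ∑ i ∈ Finset.range (n + 2),
        (1 - (i : ℂ) / (n + 1 : ℕ)) * ((n + 1).choose i : ℂ) * F (n + 1 - i) i := by
  have h0 : ((n + 1 : ℕ) : ℂ) ≠ 0 := by exact_mod_cast Nat.succ_ne_zero n
  rw [← Finset.sum_range_reflect, Finset.sum_range_succ _ (n + 1), div_self h0, sub_self, zero_mul,
    zero_mul, add_zero]
  refine Finset.sum_congr rfl fun i hi => ?_
  have hi : i ≤ n := by
    rw [Finset.mem_range] at hi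
    omega
  rw [show n + 1 - 1 - i = n - i by omega, show n - (n - i) = i by omega,
    show n - i + 1 = n + 1 - i by omega, Nat.choose_symm hi]
  have h1 : (n.choose i : ℂ) * (n + 1 : ℕ) = (n + 1).choose i * ((n + 1 : ℕ) - i) := by
    rw [← Nat.cast_sub (by omega)]
    exact_mod_cast Nat.choose_mul_succ_eq n i
  congr 1
  field_simp
  rw [h1]
  ring

theorem sum_choose_mul_succ_right (F : ℕ → ℕ → ℂ) (n : ℕ) :
    ∑ i ∈ Finset.range (n + 1), (n.choose i : ℂ) * F i (n - i + 1) =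
      ∑ i ∈ Finset.range (n + 2),
        ((i : ℂ) / (n + 1 : ℕ)) * ((n + 1).choose i : ℂ) * F (n + 1 - i) i := by
  have h0 : ((n + 1 : ℕ) : ℂ) ≠ 0 := by exact_mod_cast Nat.succ_ne_zero n
  rw [← Finset.sum_range_reflect, Finset.sum_range_succ' _ (n + 1), Nat.cast_zero, zero_div,
    zero_mul, zero_mul, add_zero]
  refine Finset.sum_congr rfl fun i hi => ?_
  have hi : i ≤ n := by
    rw [Finset.mem_range] at hi
    omega
  rw [show n + 1 - 1 - i = n - i by omega, show n - (n - i) = i by omega,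
    show n + 1 - (i + 1) = n - i by omega, Nat.choose_symm hi]
  have h1 : ((n + 1 : ℕ) : ℂ) * n.choose i = (n + 1).choose (i + 1) * (i + 1 : ℕ) := by
    exact_mod_cast Nat.add_one_mul_choose_eq n i
  congr 1
  field_simp
  linear_combination h1

/-- Raising the binomial coefficients to `k + 1` and `l + 1` gives the two products the weights `(1
- s) t` and `s (1 - t)` with `s = i/(k+1)`, `t = j/(l+1)`. Half their sum is `s/2 + t/2 - st`, the
factor in `coefa`. It vanishes at the corner `s = t = 1`, so the corner can be removed. -/
theorem leibniz_sum_eq_sum_coefa (w : ℝ × ℝ → ℝ) (x : ℝ × ℝ) (Q : ℕ → ℕ → ℂ) (k l : ℕ) :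
    1 / 2 * (∑ j ∈ Finset.range (l + 1), ∑ i ∈ Finset.range (k + 1),
        (k.choose i : ℂ) * (l.choose j : ℂ) * (cderiv (i + 1) j w x * Q (k - i) (l - j + 1)))
      + 1 / 2 * (∑ j ∈ Finset.range (l + 1), ∑ i ∈ Finset.range (k + 1),
        (k.choose i : ℂ) * (l.choose j : ℂ) * (cderiv i (j + 1) w x * Q (k - i + 1) (l - j)))
      = ∑ q ∈ rect (k + 1) (l + 1) 0 0, coefa w x (k + 1) (l + 1) q.1 q.2 * Q q.1 q.2 := by
  have hk : ((k + 1 : ℕ) : ℂ) ≠ 0 := by exact_mod_cast Nat.succ_ne_zero k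
  have hl : ((l + 1 : ℕ) : ℂ) ≠ 0 := by exact_mod_cast Nat.succ_ne_zero l
  have hcorner : coefa w x (k + 1) (l + 1) (k + 1) (l + 1) = 0 := by
    rw [coefa, show (((k + 1 : ℕ) : ℂ) / (2 * (k + 1 : ℕ)) + ((l + 1 : ℕ) : ℂ) / (2 * (l + 1 : ℕ))
      - ((k + 1 : ℕ) : ℂ) * (l + 1 : ℕ) / ((k + 1 : ℕ) * (l + 1 : ℕ))) = 0 by field_simp; norm_num]
    simp
  have hR : ∑ q ∈ rect (k + 1) (l + 1) 0 0, coefa w x (k + 1) (l + 1) q.1 q.2 * Q q.1 q.2 =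
      ∑ j ∈ Finset.range (l + 2), ∑ i ∈ Finset.range (k + 2),
        coefa w x (k + 1) (l + 1) i j * Q i j := by
    rw [Finset.sum_comm, ← Finset.sum_product', rect]
    have : Finset.Icc 0 (k + 1) ×ˢ Finset.Icc 0 (l + 1)
        = Finset.range (k + 2) ×ˢ Finset.range (l + 2) := by
      ext ⟨i, j⟩
      simp
      omega
    rw [this]
    refine Finset.sum_erase _ ?_
    rw [hcorner, zero_mul]
  have h1 : ∑ j ∈ Finset.range (l + 1), ∑ i ∈ Finset.range (k + 1),
      (k.choose i : ℂ) * (l.choose j : ℂ) * (cderiv (i + 1) j w x * Q (k - i) (l - j + 1)) =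
      ∑ j ∈ Finset.range (l + 2), ∑ i ∈ Finset.range (k + 2),
        ((j : ℂ) / (l + 1 : ℕ)) * ((l + 1).choose j : ℂ) *
          ((1 - (i : ℂ) / (k + 1 : ℕ)) * ((k + 1).choose i : ℂ) *
            (cderiv (k + 1 - i) (l + 1 - j) w x * Q i j)) := by
    have e (a b : ℕ) := sum_choose_mul_succ_left (fun i' i => cderiv i' a w x * Q i b) k
    simp only [← Finset.mul_sum, ← e]
    rw [← sum_choose_mul_succ_right (fun j' j => ∑ i ∈ Finset.range (k + 1), (k.choose i : ℂ) *
      (cderiv (i + 1) j' w x * Q (k - i) j))]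
    refine Finset.sum_congr rfl fun j _ => ?_
    rw [Finset.mul_sum]
    refine Finset.sum_congr rfl fun i _ => ?_
    ring
  have h2 : ∑ j ∈ Finset.range (l + 1), ∑ i ∈ Finset.range (k + 1),
      (k.choose i : ℂ) * (l.choose j : ℂ) * (cderiv i (j + 1) w x * Q (k - i + 1) (l - j)) =
      ∑ j ∈ Finset.range (l + 2), ∑ i ∈ Finset.range (k + 2),
        (1 - (j : ℂ) / (l + 1 : ℕ)) * ((l + 1).choose j : ℂ) *
          (((i : ℂ) / (k + 1 : ℕ)) * ((k + 1).choose i : ℂ) *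
            (cderiv (k + 1 - i) (l + 1 - j) w x * Q i j)) := by
    have e (a b : ℕ) := sum_choose_mul_succ_right (fun i' i => cderiv i' a w x * Q i b) k
    simp only [← Finset.mul_sum, ← e]
    rw [← sum_choose_mul_succ_left (fun j' j => ∑ i ∈ Finset.range (k + 1), (k.choose i : ℂ) *
      (cderiv i j' w x * Q (k - i + 1) j))]
    refine Finset.sum_congr rfl fun j _ => ?_
    rw [Finset.mul_sum]
    refine Finset.sum_congr rfl fun i _ => ?_
    ring
  rw [h1, h2, hR, Finset.mul_sum, Finset.mul_sum, ← Finset.sum_add_distrib]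
  refine Finset.sum_congr rfl fun j _ => ?_
  rw [Finset.mul_sum, Finset.mul_sum, ← Finset.sum_add_distrib]
  refine Finset.sum_congr rfl fun i _ => ?_
  rw [coefa]
  field_simp
  ring

theorem iterate_dop_succ_comm {Ω : Set (ℝ × ℝ)} (hΩ : IsOpen Ω) {c d c' d' : ℂ} {v : ℝ × ℝ → ℂ}
    (i j : ℕ) (hv : ContDiffOn ℝ (i + j + 1 : ℕ) v Ω) :
    Set.EqOn ((dop c d)^[i] ((dop c' d')^[j] (dop c d v)))
      ((dop c d)^[i + 1] ((dop c' d')^[j] v)) Ω :=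
  iterate_dop_congr hΩ i (iterate_dop_dop_comm hΩ j (hv.of_le (by exact_mod_cast (by omega))))

/-- No regularity of `f` is assumed; it is inherited through the equation from `∂∂̄u` of class `C⁶`
and `∂ã`, `∂̄ã` of class `C⁵`. -/
theorem contDiffOn_fTilde {Ω : Set (ℝ × ℝ)} {a f u : ℝ × ℝ → ℝ} (ha : IsDiffusion Ω a)
    (hu : ContDiffOn ℝ 8 u Ω) (h : SolvesPDE Ω a f u) :
    ContDiffOn ℝ (5 : ℕ) (fun t => (fTilde a f t : ℂ)) Ω := by
  have hU : ContDiffOn ℝ (8 : ℕ) (fun t => (u t : ℂ)) Ω := contDiffOn_ofReal hu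
  have hW : ContDiffOn ℝ (6 : ℕ) (fun t => (aTilde a t : ℂ)) Ω :=
    contDiffOn_ofReal (contDiffOn_aTilde ha)
  have h5 : ((5 : ℕ) : WithTop ℕ∞) ≤ (7 : ℕ) := by exact_mod_cast (by norm_num)
  have e : Set.EqOn (fun t => (fTilde a f t : ℂ)) (fun y => 4 * dz (dzbar fun t => (u t : ℂ)) y -
      2 * (dz (fun t => (aTilde a t : ℂ)) y * dzbar (fun t => (u t : ℂ)) y
        + dzbar (fun t => (aTilde a t : ℂ)) y * dz (fun t => (u t : ℂ)) y)) Ω := by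
    intro y hy
    simp only [dz_dzbar_eq ha hu h hy]
    ring
  refine ContDiffOn.congr ?_ e
  rw [dz_eq_dop, dzbar_eq_dop]
  have hZ := contDiffOn_dop ha.isOpen (c := 1 / 2) (d := -(Complex.I / 2)) hU
  have hZb := contDiffOn_dop ha.isOpen (c := 1 / 2) (d := Complex.I / 2) hU
  have hZZ := contDiffOn_dop ha.isOpen (n := 6) (c := 1 / 2) (d := -(Complex.I / 2)) hZb
  have hw := contDiffOn_dop ha.isOpen (n := 5) (c := 1 / 2) (d := -(Complex.I / 2)) hW
  have hwb := contDiffOn_dop ha.isOpen (n := 5) (c := 1 / 2) (d := Complex.I / 2) hW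
  exact (contDiffOn_const.mul (hZZ.of_le (by exact_mod_cast (by norm_num)))).sub
    (contDiffOn_const.mul ((hw.mul (hZb.of_le h5)).add (hwb.mul (hZ.of_le h5))))

theorem cderiv_succ_succ {Ω : Set (ℝ × ℝ)} {a f u : ℝ × ℝ → ℝ} (ha : IsDiffusion Ω a)
    (hu : ContDiffOn ℝ 8 u Ω) (h : SolvesPDE Ω a f u) {x : ℝ × ℝ} (hx : x ∈ Ω) {k l : ℕ}
    (hkl : k + l ≤ 5) :
    cderiv (k + 1) (l + 1) u x = ∑ q ∈ rect (k + 1) (l + 1) 0 0,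
      coefa (aTilde a) x (k + 1) (l + 1) q.1 q.2 * cderiv q.1 q.2 u x
      + 1 / 4 * cderiv k l (fTilde a f) x := by
  have hΩ := ha.isOpen
  have hU : ContDiffOn ℝ (8 : ℕ) (fun t => (u t : ℂ)) Ω := contDiffOn_ofReal hu
  have hW : ContDiffOn ℝ (6 : ℕ) (fun t => (aTilde a t : ℂ)) Ω :=
    contDiffOn_ofReal (contDiffOn_aTilde ha)
  have hG := contDiffOn_fTilde ha hu h
  have e := fun y hy => dz_dzbar_eq ha hu h (y := y) hy
  simp only [cderiv, dz_eq_dop, dzbar_eq_dop] at e ⊢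
  set Z := dop (1 / 2) (-(Complex.I / 2)) with hZdef
  set Zb := dop (1 / 2) (Complex.I / 2) with hZbdef
  set U : ℝ × ℝ → ℂ := fun t => (u t : ℂ)
  set W : ℝ × ℝ → ℂ := fun t => (aTilde a t : ℂ)
  set G : ℝ × ℝ → ℂ := fun t => (fTilde a f t : ℂ)
  have hle : ∀ {m n : ℕ}, m ≤ n → ((m : ℕ) : WithTop ℕ∞) ≤ (n : ℕ) := fun hmn => by
    exact_mod_cast hmn
  have hZU : ContDiffOn ℝ (7 : ℕ) (Z U) Ω := contDiffOn_dop hΩ hU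
  have hZbU : ContDiffOn ℝ (7 : ℕ) (Zb U) Ω := contDiffOn_dop hΩ hU
  have hZW : ContDiffOn ℝ (5 : ℕ) (Z W) Ω := contDiffOn_dop hΩ hW
  have hZbW : ContDiffOn ℝ (5 : ℕ) (Zb W) Ω := contDiffOn_dop hΩ hW
  -- The three terms of the equation become one linear combination, to which `iterate_dop_sum`
  -- applies twice.
  let A : Fin 3 → ℂ := ![1 / 2, 1 / 2, 1 / 4]
  let V : Fin 3 → ℝ × ℝ → ℂ := ![fun t => Z W t * Zb U t, fun t => Zb W t * Z U t, G]
  have hV : ∀ i ∈ Finset.univ, ContDiffOn ℝ (k + l : ℕ) (V i) Ω := by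
    intro i _
    have h5 : ContDiffOn ℝ (5 : ℕ) (V i) Ω := by
      fin_cases i
      · exact hZW.mul (hZbU.of_le (hle (by norm_num)))
      · exact hZbW.mul (hZU.of_le (hle (by norm_num)))
      · exact hG
    exact h5.of_le (hle hkl)
  have e' : Set.EqOn (Z (Zb U)) (fun t => ∑ i, A i * V i t) Ω := by
    intro y hy
    rw [e y hy]
    simp only [Fin.sum_univ_three, A, V, Matrix.cons_val_zero, Matrix.cons_val_one,
      Matrix.cons_val]
    ring
  have step : Z^[k + 1] (Zb^[l + 1] U) x = ∑ i, A i * Z^[k] (Zb^[l] (V i)) x := by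
    have s1 : Z^[k + 1] (Zb^[l + 1] U) x = Z^[k] (Zb^[l] (Z (Zb U))) x :=
      (iterate_dop_succ_comm hΩ k l (hZbU.of_le (hle (by omega))) hx).symm
    rw [s1, iterate_dop_congr hΩ k (iterate_dop_congr hΩ l e') hx,
      iterate_dop_congr hΩ k (iterate_dop_sum hΩ _ l
        fun i hi => (hV i hi).of_le (hle (by omega))) hx,
      iterate_dop_sum hΩ _ k (fun i hi => contDiffOn_iterate_dop hΩ l (hV i hi)) hx]
  rw [step, ← leibniz_sum_eq_sum_coefa (aTilde a) x (fun i j => Z^[i] (Zb^[j] U) x)]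
  simp only [Fin.sum_univ_three, A, V, Matrix.cons_val_zero, Matrix.cons_val_one, Matrix.cons_val]
  rw [iterate_dop_iterate_dop_mul hΩ k l (hZW.of_le (hle hkl))
    (hZbU.of_le (hle (by omega))) hx, iterate_dop_iterate_dop_mul hΩ k l (hZbW.of_le (hle hkl))
    (hZU.of_le (hle (by omega))) hx]
  congr 3
  · refine Finset.sum_congr rfl fun j hj => Finset.sum_congr rfl fun i hi => ?_
    rw [Finset.mem_range] at hi hj
    rw [iterate_dop_succ_comm hΩ i j (hW.of_le (hle (by omega))) hx, cderiv, dz_eq_dop,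
      dzbar_eq_dop]
    rfl
  · refine Finset.sum_congr rfl fun j hj => Finset.sum_congr rfl fun i hi => ?_
    rw [Finset.mem_range] at hi hj
    rw [iterate_dop_succ_comm hΩ (k - i) (l - j) (hU.of_le (hle (by omega))) hx, cderiv, dz_eq_dop,
      dzbar_eq_dop]
    rfl

/-- The pairs `(m, n)` with `m n = 0` and `m, n ≤ 7`. -/
def axes : Finset (ℕ × ℕ) := (Finset.range 8 ×ˢ Finset.range 8).filter fun q => q.1 * q.2 = 0

/-- The derivatives of a solution are determined by those of index on the axes. -/
theorem cderiv_eq_sum_axes {Ω : Set (ℝ × ℝ)} {a f u : ℝ × ℝ → ℝ} (ha : IsDiffusion Ω a)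
    (hu : ContDiffOn ℝ 8 u Ω) (h : SolvesPDE Ω a f u) {x : ℝ × ℝ} (hx : x ∈ Ω) {k l : ℕ}
    (hkl : k + l ≤ 7) :
    cderiv k l u x = ∑ q ∈ axes, coefA (aTilde a) x q.1 q.2 k l * cderiv q.1 q.2 u x
      + coefF (aTilde a) (fTilde a f) x k l := by
  induction hn : k + l using Nat.strong_induction_on generalizing k l with
  | _ N ih =>
    by_cases h0 : k * l = 0
    · rw [coefF_boundary _ _ _ h0, add_zero, Finset.sum_eq_single (k, l)]
      · simp [coefA_boundary _ _ _ _ h0]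
      · rintro ⟨i, j⟩ _ hij
        rw [coefA_boundary _ _ _ _ h0, if_neg (by rintro ⟨rfl, rfl⟩; exact hij rfl), zero_mul]
      · intro hq
        refine absurd ?_ hq
        simp only [axes, Finset.mem_filter, Finset.mem_product, Finset.mem_range]
        exact ⟨by omega, h0⟩
    · rw [coefF_rec _ _ _ h0]
      simp only [coefA_rec_full _ _ _ _ h0, Finset.sum_mul]
      obtain ⟨k, rfl⟩ := Nat.exists_eq_succ_of_ne_zero (left_ne_zero_of_mul h0)
      obtain ⟨l, rfl⟩ := Nat.exists_eq_succ_of_ne_zero (right_ne_zero_of_mul h0)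
      rw [Finset.sum_comm, ← add_assoc, ← Finset.sum_add_distrib]
      simp only [Nat.succ_eq_add_one, Nat.add_sub_cancel] at hn hkl ⊢
      rw [cderiv_succ_succ ha hu h hx (by omega)]
      congr 1
      refine Finset.sum_congr rfl fun q hq => ?_
      have hlt := rect_lt hq
      rw [ih _ (hn ▸ hlt) (by omega) rfl, mul_add, Finset.mul_sum]
      congr 1
      refine Finset.sum_congr rfl fun r _ => ?_
      ring

theorem conj_coefA {w : ℝ × ℝ → ℝ} {x : ℝ × ℝ} (hw : RealJet w x) (m n : ℕ) {k l : ℕ}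
    (hkl : k + l ≤ 7) : conj (coefA w x m n k l) = coefA w x n m l k := by
  induction hN : k + l using Nat.strong_induction_on generalizing k l with
  | _ N ih =>
    by_cases h0 : k * l = 0
    · rw [coefA_boundary _ _ _ _ h0, coefA_boundary _ _ _ _ (by rwa [mul_comm])]
      simp only [and_comm]
      split_ifs <;> simp
    · rw [coefA_rec_full _ _ _ _ h0, coefA_rec_full _ _ _ _ (by rwa [mul_comm]), map_sum]
      refine Finset.sum_nbij' Prod.swap Prod.swap ?_ ?_ (by simp) (by simp) ?_
      · rintro ⟨i, j⟩
        simp [rect]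
        tauto
      · rintro ⟨i, j⟩
        simp [rect]
        tauto
      · rintro ⟨i, j⟩ hq
        have hlt := rect_lt hq
        simp only [Prod.fst_swap, Prod.snd_swap] at hlt ⊢
        rw [map_mul, ih _ (hN ▸ hlt) (by omega) rfl]
        -- The index `(0, 0)` may involve a derivative of order 7, outside the scope of `RealJet`,
        -- but its coefficient vanishes.
        by_cases hij : i = 0 ∧ j = 0
        · rw [hij.1, hij.2, coefa_zero_zero, coefa_zero_zero]
          simp
        · congr 1
          simp only [rect, Finset.mem_erase, Finset.mem_product, Finset.mem_Icc] at hq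
          simp only [coefa, map_mul, map_sub, map_add, map_div₀, map_natCast, map_ofNat]
          rw [hw (k - i) (l - j) (by omega)]
          ring

theorem conj_taylorA {w : ℝ × ℝ → ℝ} {x : ℝ × ℝ} (hw : RealJet w x) {k : ℕ} (hk : k ≤ 7)
    (m n : ℕ) (p : ℤ × ℤ) : conj (taylorA w x k m n p) = taylorA w x k n m p := by
  rw [taylorA_eq_sum, taylorA_eq_sum, map_sum, ← Finset.sum_range_reflect]
  refine Finset.sum_congr rfl fun i hi => ?_
  rw [Finset.mem_range] at hi
  rw [map_mul, conj_monoN, conj_coefA hw m n (by omega), show k + 1 - 1 - i = k - i by omega,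
    show k - (k - i) = i by omega]

/-! ### Taylor expansion along segments. -/

/-- The segment from `x` to `x + p h`. -/
def segmentPath (x : ℝ × ℝ) (p : ℤ × ℤ) (h : ℝ) (t : ℝ) : ℝ × ℝ :=
  (x.1 + t * (p.1 * h), x.2 + t * (p.2 * h))

theorem contDiff_segmentPath (x : ℝ × ℝ) (p : ℤ × ℤ) (h : ℝ) {n : WithTop ℕ∞} :
    ContDiff ℝ n (segmentPath x p h) := by
  unfold segmentPath
  fun_prop

theorem abs_le_one_of_mem_stencil {p : ℤ × ℤ} (hp : p ∈ stencil) :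
    |(p.1 : ℝ)| ≤ 1 ∧ |(p.2 : ℝ)| ≤ 1 := by
  simp only [stencil, Finset.mem_product, Finset.mem_Icc] at hp
  rw [abs_le, abs_le]
  exact_mod_cast hp

theorem segmentPath_mem_square (x : ℝ × ℝ) {p : ℤ × ℤ} (hp : p ∈ stencil) {h : ℝ} (hh : 0 < h)
    {t : ℝ} (ht : t ∈ Set.Icc (0 : ℝ) 1) : segmentPath x p h t ∈ square x h := by
  have key : ∀ a : ℝ, |a| ≤ 1 → -h ≤ t * (a * h) ∧ t * (a * h) ≤ h := by
    intro a ha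
    rw [← abs_le, abs_mul, abs_mul, abs_of_nonneg ht.1, abs_of_pos hh]
    calc t * (|a| * h) ≤ 1 * (1 * h) := by
          gcongr
          exact ht.2
      _ = h := by ring
  obtain ⟨h1, h2⟩ := abs_le_one_of_mem_stencil hp
  have k1 := key _ h1
  have k2 := key _ h2
  refine ⟨⟨?_, ?_⟩, ?_, ?_⟩ <;> simp only [segmentPath] <;> linarith

theorem hasDerivAt_comp_segmentPath (x : ℝ × ℝ) (p : ℤ × ℤ) (h : ℝ) {v : ℝ × ℝ → ℂ} {t : ℝ}
    (hv : DifferentiableAt ℝ v (segmentPath x p h t)) :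
    HasDerivAt (fun s => v (segmentPath x p h s))
      (dop (p.1 * h) (p.2 * h) v (segmentPath x p h t)) t := by
  have hγ : HasDerivAt (segmentPath x p h) (p.1 * h, p.2 * h) t := by
    have h1 := ((hasDerivAt_id t).mul_const ((p.1 : ℝ) * h)).const_add x.1
    have h2 := ((hasDerivAt_id t).mul_const ((p.2 : ℝ) * h)).const_add x.2
    rw [one_mul] at h1 h2
    exact h1.prodMk h2
  have := hv.hasFDerivAt.comp_hasDerivAt t hγ
  have e : ((p.1 * h, p.2 * h) : ℝ × ℝ) = (p.1 * h : ℝ) • (1, 0) + (p.2 * h : ℝ) • (0, 1) := by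
    simp
  rw [e, map_add, map_smul, map_smul] at this
  simpa [dop, dx, dy, Function.comp_def] using this

theorem iteratedDerivWithin_segmentPath {Ω : Set (ℝ × ℝ)} (hΩ : IsOpen Ω) {x : ℝ × ℝ} {p : ℤ × ℤ}
    (hp : p ∈ stencil) {h : ℝ} (hh : 0 < h) (hsq : square x h ⊆ Ω) {v : ℝ × ℝ → ℂ} {n : ℕ}
    (hv : ContDiffOn ℝ n v Ω) {t : ℝ} (ht : t ∈ Set.Icc (0 : ℝ) 1) :
    iteratedDerivWithin n (fun s => v (segmentPath x p h s)) (Set.Icc 0 1) t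
      = (dop (p.1 * h) (p.2 * h))^[n] v (segmentPath x p h t) := by
  induction n generalizing t with
  | zero => simp
  | succ n ih =>
    have hv' : ContDiffOn ℝ n v Ω := hv.of_le (by exact_mod_cast (by omega))
    rw [iteratedDerivWithin_succ, derivWithin_congr (fun s hs => ih hv' hs) (ih hv' ht),
      Function.iterate_succ_apply']
    exact (hasDerivAt_comp_segmentPath x p h (differentiableAt_iterate_dop hΩ (Nat.lt_succ_self n)
      hv (hsq (segmentPath_mem_square x hp hh ht)))).hasDerivWithinAt.derivWithin
        (uniqueDiffOn_Icc zero_lt_one t ht)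

/-- The derivative in direction `ph` is `h (z ∂ + z̄ ∂̄)`; the binomial formula for its powers
produces the monomials `N^{i,n-i}`. -/
theorem iterate_dop_direction {Ω : Set (ℝ × ℝ)} (hΩ : IsOpen Ω) {u : ℝ × ℝ → ℝ} {n : ℕ}
    (hu : ContDiffOn ℝ n u Ω) (p : ℤ × ℤ) (h : ℝ) {y : ℝ × ℝ} (hy : y ∈ Ω) :
    (dop (p.1 * h) (p.2 * h))^[n] (fun t => (u t : ℂ)) y = ∑ i ∈ Finset.range (n + 1),
      (n.factorial : ℂ) * (monoN i (n - i) p * cderiv i (n - i) u y * (h : ℂ) ^ n) := by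
  have e1 : (p.1 * h : ℂ) = ((p.1 : ℂ) + Complex.I * p.2) * h * (1 / 2)
      + ((p.1 : ℂ) - Complex.I * p.2) * h * (1 / 2) := by ring
  have e2 : (p.2 * h : ℂ) = ((p.1 : ℂ) + Complex.I * p.2) * h * (-(Complex.I / 2))
      + ((p.1 : ℂ) - Complex.I * p.2) * h * (Complex.I / 2) := by
    linear_combination (p.2 * h : ℂ) * Complex.I_sq
  rw [e1, e2, iterate_dop_binomial hΩ _ _ n (contDiffOn_ofReal hu) hy]
  refine Finset.sum_congr rfl fun i hi => ?_
  have hi : i ≤ n := by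
    rw [Finset.mem_range] at hi
    omega
  have hf : (n.factorial : ℂ) = n.choose i * i.factorial * (n - i).factorial := by
    exact_mod_cast (Nat.choose_mul_factorial_mul_factorial hi).symm
  have h1 : (i.factorial : ℂ) ≠ 0 := by exact_mod_cast i.factorial_ne_zero
  have h2 : ((n - i).factorial : ℂ) ≠ 0 := by exact_mod_cast (n - i).factorial_ne_zero
  rw [hf, monoN, cderiv, dz_eq_dop, dzbar_eq_dop, mul_pow, mul_pow]
  have hh : (h : ℂ) ^ n = (h : ℂ) ^ i * (h : ℂ) ^ (n - i) := by
    rw [← pow_add, Nat.add_sub_cancel' hi]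
  rw [hh]
  field_simp

theorem norm_iterate_dop_direction_le {Ω : Set (ℝ × ℝ)} (hΩ : IsOpen Ω) {u : ℝ × ℝ → ℝ} {n : ℕ}
    (hu : ContDiffOn ℝ n u Ω) {p : ℤ × ℤ} (hp : p ∈ stencil) {h : ℝ} (hh : 0 < h) {K : ℝ}
    {y : ℝ × ℝ} (hy : y ∈ Ω) (hK : JetBound u n K y) :
    ‖(dop (p.1 * h) (p.2 * h))^[n] (fun t => (u t : ℂ)) y‖ ≤ 4 ^ n * K * h ^ n := by
  have hK0 : 0 ≤ K := (abs_nonneg _).trans (hK 0 0 (Nat.zero_le n))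
  obtain ⟨h1, h2⟩ := abs_le_one_of_mem_stencil hp
  have hz : ‖(p.1 : ℂ) + Complex.I * p.2‖ ≤ 2 := by
    refine (norm_add_le _ _).trans ?_
    rw [norm_mul, Complex.norm_I, one_mul, Complex.norm_intCast, Complex.norm_intCast]
    linarith
  have hzb : ‖(p.1 : ℂ) - Complex.I * p.2‖ ≤ 2 := by
    refine (norm_sub_le _ _).trans ?_
    rw [norm_mul, Complex.norm_I, one_mul, Complex.norm_intCast, Complex.norm_intCast]
    linarith
  rw [iterate_dop_direction hΩ hu p h hy]
  have hterm : ∀ i ∈ Finset.range (n + 1), ‖(n.factorial : ℂ) *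
      (monoN i (n - i) p * cderiv i (n - i) u y * (h : ℂ) ^ n)‖
      ≤ (n.choose i : ℝ) * (2 ^ n * K * h ^ n) := by
    intro i hi
    have hi : i ≤ n := by
      rw [Finset.mem_range] at hi
      omega
    have hf : (n.factorial : ℝ) = n.choose i * (i.factorial * (n - i).factorial) := by
      rw [← mul_assoc]
      exact_mod_cast (Nat.choose_mul_factorial_mul_factorial hi).symm
    have h3 : (0 : ℝ) < i.factorial * (n - i).factorial := by positivity
    have hN : ‖monoN i (n - i) p‖ ≤ 2 ^ n / (i.factorial * (n - i).factorial) := by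
      rw [monoN, norm_div, norm_mul, norm_mul, norm_pow, norm_pow, Complex.norm_natCast,
        Complex.norm_natCast]
      gcongr
      calc _ ≤ (2 : ℝ) ^ i * 2 ^ (n - i) := by gcongr
        _ = 2 ^ n := by rw [← pow_add, Nat.add_sub_cancel' hi]
    rw [norm_mul, norm_mul, norm_mul, norm_pow, Complex.norm_real, Complex.norm_natCast,
      Real.norm_of_nonneg hh.le, hf]
    calc _ ≤ (n.choose i * (i.factorial * (n - i).factorial) : ℝ) *
          (2 ^ n / (i.factorial * (n - i).factorial) * K * h ^ n) := by
          gcongr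
          exact norm_cderiv_le hΩ hu hy hK (by omega)
      _ = _ := by field_simp
  refine (norm_sum_le_of_le _ hterm).trans_eq ?_
  rw [← Finset.sum_mul]
  have : ∑ i ∈ Finset.range (n + 1), (n.choose i : ℝ) = 2 ^ n := by
    exact_mod_cast Nat.sum_range_choose n
  rw [this, show (4 : ℝ) = 2 * 2 by norm_num, mul_pow]
  ring

theorem norm_sub_taylor_le {Ω : Set (ℝ × ℝ)} (hΩ : IsOpen Ω) {u : ℝ × ℝ → ℝ}
    (hu : ContDiffOn ℝ 8 u Ω) {x : ℝ × ℝ} {p : ℤ × ℤ} (hp : p ∈ stencil) {h : ℝ} (hh : 0 < h)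
    (hsq : square x h ⊆ Ω) {K : ℝ} (hK : ∀ y ∈ square x h, JetBound u 8 K y) :
    ‖(u (shift x p h) : ℂ) - ∑ k ∈ Finset.range 8, ∑ i ∈ Finset.range (k + 1),
      monoN i (k - i) p * cderiv i (k - i) u x * (h : ℂ) ^ k‖ ≤ 4 ^ 8 * K * h ^ 8 := by
  have hu8 : ContDiffOn ℝ (8 : ℕ) u Ω := hu
  have hU : ContDiffOn ℝ (8 : ℕ) (fun t => (u t : ℂ)) Ω := contDiffOn_ofReal hu8
  have hγ : ∀ t ∈ Set.Icc (0 : ℝ) 1, segmentPath x p h t ∈ square x h := fun t ht =>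
    segmentPath_mem_square x hp hh ht
  have h0 : (0 : ℝ) ∈ Set.Icc (0 : ℝ) 1 := ⟨le_rfl, zero_le_one⟩
  have hx0 : segmentPath x p h 0 = x := by simp [segmentPath]
  have hx : x ∈ square x h := by simpa only [hx0] using hγ 0 h0
  have hφ : ContDiffOn ℝ ((7 : ℕ) + 1) (fun s => (u (segmentPath x p h s) : ℂ)) (Set.Icc 0 1) :=
    (hU.comp (contDiff_segmentPath x p h).contDiffOn fun t ht => hsq (hγ t ht)).of_le
      (by norm_cast)
  have hT := taylor_mean_remainder_bound (n := 7) (C := 4 ^ 8 * K * h ^ 8) zero_le_one hφ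
    (x := 1) ⟨zero_le_one, le_rfl⟩ fun t ht => by
      rw [iteratedDerivWithin_segmentPath (n := 8) hΩ hp hh hsq hU ht]
      exact norm_iterate_dop_direction_le (n := 8) hΩ hu8 hp hh (hsq (hγ t ht)) (hK _ (hγ t ht))
  have h1 : segmentPath x p h 1 = shift x p h := by simp [segmentPath, shift]
  rw [h1, taylor_within_apply] at hT
  have hsum : ∑ k ∈ Finset.range (7 + 1), ((k.factorial : ℝ)⁻¹ * (1 - 0) ^ k) •
      iteratedDerivWithin k (fun s => (u (segmentPath x p h s) : ℂ)) (Set.Icc 0 1) 0 =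
      ∑ k ∈ Finset.range 8, ∑ i ∈ Finset.range (k + 1),
      monoN i (k - i) p * cderiv i (k - i) u x * (h : ℂ) ^ k := by
    refine Finset.sum_congr rfl fun k hk => ?_
    rw [Finset.mem_range] at hk
    have hk' : ((k : ℕ) : WithTop ℕ∞) ≤ (8 : ℕ) := by exact_mod_cast (by omega)
    rw [iteratedDerivWithin_segmentPath hΩ hp hh hsq (hU.of_le hk') h0, hx0,
      iterate_dop_direction hΩ (hu8.of_le hk') p h (hsq hx), ← Finset.mul_sum, Complex.real_smul]
    have : (k.factorial : ℂ) ≠ 0 := by exact_mod_cast k.factorial_ne_zero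
    push_cast
    rw [sub_zero, one_pow, mul_one, inv_mul_cancel_left₀ this]
  rw [hsum] at hT
  refine hT.trans ?_
  have hK0 : 0 ≤ K := (abs_nonneg _).trans (hK x hx 0 0 (Nat.zero_le 8))
  rw [sub_zero, one_pow, mul_one]
  -- The factor `1/7!` of the remainder is discarded. The constant `4^8` combines `|z| ≤ 2` with a
  -- binomial sum `2^8`.
  refine div_le_self (by positivity) ?_
  exact_mod_cast Nat.one_le_iff_ne_zero.2 (Nat.factorial_ne_zero 7)

/-! ### Cancellation of the low orders and consistency. -/

theorem taylorF_eq_sum (w g : ℝ × ℝ → ℝ) (x : ℝ × ℝ) (M : ℕ) (h : ℝ) (p : ℤ × ℤ) :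
    taylorF w g x M h p = ∑ k ∈ Finset.range (M + 2), ∑ i ∈ Finset.range (k + 1),
      monoN i (k - i) p * coefF w g x i (k - i) * (h : ℂ) ^ k := by
  have h1 := Finset.sum_range_diag_flip (M + 2) fun i l =>
    monoN i l p * coefF w g x i l * (h : ℂ) ^ (i + l)
  have h2 : ∑ k ∈ Finset.range (M + 2), ∑ i ∈ Finset.range (k + 1),
      monoN i (k - i) p * coefF w g x i (k - i) * (h : ℂ) ^ k =
      ∑ k ∈ Finset.range (M + 2), ∑ i ∈ Finset.range (k + 1),
      monoN i (k - i) p * coefF w g x i (k - i) * (h : ℂ) ^ (i + (k - i)) := by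
    refine Finset.sum_congr rfl fun k _ => Finset.sum_congr rfl fun i hi => ?_
    rw [Finset.mem_range] at hi
    rw [Nat.add_sub_cancel' (by omega)]
  rw [h2, h1, taylorF, Finset.sum_filter, Finset.sum_product]
  refine Finset.sum_congr rfl fun i hi => ?_
  rw [← Finset.sum_filter]
  congr 1
  ext l
  simp at hi ⊢
  omega

theorem taylor_sum_eq {Ω : Set (ℝ × ℝ)} {a f u : ℝ × ℝ → ℝ} (ha : IsDiffusion Ω a)
    (hu : ContDiffOn ℝ 8 u Ω) (hs : SolvesPDE Ω a f u) {x : ℝ × ℝ} (hx : x ∈ Ω) (h : ℝ)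
    (p : ℤ × ℤ) :
    ∑ k ∈ Finset.range 8, ∑ i ∈ Finset.range (k + 1),
      monoN i (k - i) p * cderiv i (k - i) u x * (h : ℂ) ^ k
      = taylorF (aTilde a) (fTilde a f) x 6 h p + ∑ q ∈ axes, cderiv q.1 q.2 u x *
        ∑ k ∈ Finset.range 8, (h : ℂ) ^ k * taylorA (aTilde a) x k q.1 q.2 p := by
  rw [taylorF_eq_sum]
  simp only [Finset.mul_sum]
  rw [Finset.sum_comm, ← Finset.sum_add_distrib]
  refine Finset.sum_congr rfl fun k hk => ?_
  rw [Finset.mem_range] at hk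
  simp only [taylorA_eq_sum, Finset.mul_sum]
  rw [Finset.sum_comm, ← Finset.sum_add_distrib]
  refine Finset.sum_congr rfl fun i hi => ?_
  rw [Finset.mem_range] at hi
  rw [cderiv_eq_sum_axes ha hu hs hx (show i + (k - i) ≤ 7 by omega), mul_add, add_mul, add_comm,
    Finset.mul_sum, Finset.sum_mul]
  congr 1
  refine Finset.sum_congr rfl fun q _ => ?_
  ring

/-- The left-hand side is the coefficient of `h^s ∂^m u` in the expanded stencil. For `s ≥ m` it is
the equation of level `s - m`, the terms with larger `j` being zero; for `s < m` every term is zero.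
-/
theorem sum_taylorA_eq_zero {w : ℝ × ℝ → ℝ} {x : ℝ × ℝ} {c : ℤ × ℤ → ℕ → ℝ}
    (hc : ∀ j ≤ 7, LevelSystem w x c j) (m : ℕ) {s : ℕ} (hs : s ≤ 7) :
    ∑ j ∈ Finset.range (s + 1), ∑ p ∈ stencil, taylorA w x (s - j) m 0 p * (c p j : ℂ) = 0 := by
  by_cases hm : s < m
  · refine Finset.sum_eq_zero fun j _ => Finset.sum_eq_zero fun p _ => ?_
    rw [taylorA_eq_zero _ _ (by omega), zero_mul]
  · rw [← hc (s - m) (by omega) m (by omega)]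
    rw [← Finset.sum_subset (Finset.range_mono (show s - m + 1 ≤ s + 1 by omega))]
    · refine Finset.sum_congr rfl fun j hj => ?_
      rw [Finset.mem_range] at hj
      rw [show m + (s - m - j) = s - j by omega]
    · intro j hj hj'
      rw [Finset.mem_range] at hj hj'
      refine Finset.sum_eq_zero fun p _ => ?_
      rw [taylorA_eq_zero _ _ (by omega), zero_mul]

theorem RealJet.sum_taylorA_axes {w : ℝ × ℝ → ℝ} {x : ℝ × ℝ} (hw : RealJet w x)
    {c : ℤ × ℤ → ℕ → ℝ} (hc : ∀ j ≤ 7, LevelSystem w x c j) {q : ℕ × ℕ} (hq : q ∈ axes) {s : ℕ}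
    (hs : s ≤ 7) :
    ∑ j ∈ Finset.range (s + 1), ∑ p ∈ stencil, taylorA w x (s - j) q.1 q.2 p * (c p j : ℂ) = 0 := by
  obtain ⟨m, n⟩ := q
  simp only [axes, Finset.mem_filter, mul_eq_zero] at hq
  rcases hq.2 with h0 | h0
  · have h0 : m = 0 := h0
    subst h0
    have h1 := congrArg conj (sum_taylorA_eq_zero hc n hs)
    simp only [map_sum, map_mul, Complex.conj_ofReal, map_zero] at h1
    rw [← h1]
    refine Finset.sum_congr rfl fun j _ => Finset.sum_congr rfl fun p _ => ?_
    rw [conj_taylorA hw (by omega)]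
  · have h0 : n = 0 := h0
    subst h0
    exact sum_taylorA_eq_zero hc m hs

/-- The antidiagonals `j + k < n` cancel by hypothesis; every other term has `h^(j+k) ≤ h^n` because
`h ≤ 1`. -/
theorem norm_sum_pow_mul_le {h : ℝ} (h0 : 0 < h) (h1 : h ≤ 1) (n : ℕ) (g : ℕ → ℕ → ℂ)
    (hg : ∀ s < n, ∑ j ∈ Finset.range (s + 1), g j (s - j) = 0) :
    ‖∑ j ∈ Finset.range n, ∑ k ∈ Finset.range n, (h : ℂ) ^ (j + k) * g j k‖
      ≤ (∑ j ∈ Finset.range n, ∑ k ∈ Finset.range n, ‖g j k‖) * h ^ n := by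
  have hlow : ∑ j ∈ Finset.range n, ∑ k ∈ Finset.range (n - j), (h : ℂ) ^ (j + k) * g j k = 0 := by
    rw [← Finset.sum_range_diag_flip n fun j k => (h : ℂ) ^ (j + k) * g j k]
    refine Finset.sum_eq_zero fun s hs => ?_
    rw [Finset.mem_range] at hs
    rw [← mul_zero ((h : ℂ) ^ s), ← hg s hs, Finset.mul_sum]
    refine Finset.sum_congr rfl fun j hj => ?_
    rw [Finset.mem_range] at hj
    rw [Nat.add_sub_cancel' (by omega)]
  rw [← sub_zero (∑ j ∈ Finset.range n, _), ← hlow, ← Finset.sum_sub_distrib, Finset.sum_mul]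
  refine norm_sum_le_of_le _ fun j _ => ?_
  have hsub : Finset.range (n - j) ⊆ Finset.range n := Finset.range_mono (by omega)
  rw [← Finset.sum_sdiff hsub, add_sub_cancel_right]
  calc _ ≤ ∑ k ∈ Finset.range n \ Finset.range (n - j), ‖g j k‖ * h ^ n := by
        refine norm_sum_le_of_le _ fun k hk => ?_
        simp only [Finset.mem_sdiff, Finset.mem_range] at hk
        rw [norm_mul, norm_pow, Complex.norm_real, Real.norm_of_nonneg h0.le, mul_comm]
        exact mul_le_mul_of_nonneg_left (pow_le_pow_of_le_one h0.le h1 (by omega)) (norm_nonneg _)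
    _ ≤ ∑ k ∈ Finset.range n, ‖g j k‖ * h ^ n :=
        Finset.sum_le_sum_of_subset_of_nonneg Finset.sdiff_subset fun _ _ _ => by positivity
    _ = _ := (Finset.sum_mul _ _ _).symm

/-- The size of a stencil. -/
def stencilSize (w : ℝ × ℝ → ℝ) (x : ℝ × ℝ) : ℝ :=
  ∑ p ∈ stencil, ∑ j ∈ Finset.range 8, ‖signedSolution w x p j‖

/-- The size of the coefficients in the expansion of the stencil applied to a solution. -/
def residualSize (w : ℝ × ℝ → ℝ) (x : ℝ × ℝ) : ℝ :=
  ∑ q ∈ axes, ∑ j ∈ Finset.range 8, ∑ k ∈ Finset.range 8,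
    ‖∑ p ∈ stencil, taylorA w x k q.1 q.2 p * (signedSolution w x p j : ℂ)‖

theorem jetBounded_stencilSize : JetBounded stencilSize :=
  .sum _ fun p _ => .sum _ fun j _ => (jetBounded_signedSolution p j).norm

theorem jetBounded_residualSize : JetBounded residualSize :=
  .sum _ fun q _ => .sum _ fun j _ => .sum _ fun k hk => .norm <| .sum _ fun p _ =>
    (JetBounded.taylorA (by rw [Finset.mem_range] at hk; omega) _ _ _).mul
      (jetBounded_signedSolution p j).ofReal

theorem consistency_error_le {Ω : Set (ℝ × ℝ)} {a f u : ℝ × ℝ → ℝ} (ha : IsDiffusion Ω a)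
    (hu : ContDiffOn ℝ 8 u Ω) (hs : SolvesPDE Ω a f u) {x : ℝ × ℝ} {h : ℝ} (h0 : 0 < h)
    (h1 : h ≤ 1) (hsq : square x h ⊆ Ω) {K : ℝ} (hK : ∀ y ∈ square x h, JetBound u 8 K y)
    (hw : RealJet (aTilde a) x) :
    ‖((∑ p ∈ stencil, stencilPoly 6 (signedSolution (aTilde a) x) p h * u (shift x p h) : ℝ) : ℂ)
      - ∑ p ∈ stencil, (stencilPoly 6 (signedSolution (aTilde a) x) p h : ℂ) *
        taylorF (aTilde a) (fTilde a f) x 6 h p‖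
      ≤ (stencilSize (aTilde a) x * (4 ^ 8 * K) + K * residualSize (aTilde a) x) * h ^ 8 := by
  have hx : x ∈ square x h := by
    refine ⟨⟨?_, ?_⟩, ?_, ?_⟩ <;> linarith
  set w := aTilde a with hwdef
  set c := signedSolution w x with hcdef
  set C : ℤ × ℤ → ℂ := fun p => (stencilPoly 6 c p h : ℂ) with hC
  set A : ℕ × ℕ → ℤ × ℤ → ℂ := fun q p =>
    ∑ k ∈ Finset.range 8, (h : ℂ) ^ k * taylorA w x k q.1 q.2 p with hA
  set T : ℤ × ℤ → ℂ := fun p => ∑ k ∈ Finset.range 8, ∑ i ∈ Finset.range (k + 1),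
      monoN i (k - i) p * cderiv i (k - i) u x * (h : ℂ) ^ k with hTdef
  have hT : ∀ p, T p = taylorF w (fTilde a f) x 6 h p + ∑ q ∈ axes, cderiv q.1 q.2 u x * A q p :=
    fun p => taylor_sum_eq ha hu hs (hsq hx) h p
  -- The error splits into the Taylor remainders at the nodes and the coefficients of the pure
  -- derivatives; each part is of size `h^8`.
  have hsplit : ((∑ p ∈ stencil, stencilPoly 6 c p h * u (shift x p h) : ℝ) : ℂ)
      - ∑ p ∈ stencil, C p * taylorF w (fTilde a f) x 6 h p =
      ∑ p ∈ stencil, C p * ((u (shift x p h) : ℂ) - T p)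
        + ∑ q ∈ axes, cderiv q.1 q.2 u x * ∑ p ∈ stencil, C p * A q p := by
    have e : ∑ q ∈ axes, cderiv q.1 q.2 u x * ∑ p ∈ stencil, C p * A q p
        = ∑ p ∈ stencil, C p * ∑ q ∈ axes, cderiv q.1 q.2 u x * A q p := by
      simp only [Finset.mul_sum]
      rw [Finset.sum_comm]
      refine Finset.sum_congr rfl fun p _ => Finset.sum_congr rfl fun q _ => ?_
      ring
    rw [e, ← Finset.sum_add_distrib, Complex.ofReal_sum, ← Finset.sum_sub_distrib]
    refine Finset.sum_congr rfl fun p _ => ?_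
    rw [hT p, Complex.ofReal_mul]
    ring
  have hbound1 : ‖∑ p ∈ stencil, C p * ((u (shift x p h) : ℂ) - T p)‖
      ≤ stencilSize w x * (4 ^ 8 * K) * h ^ 8 := by
    rw [mul_assoc, stencilSize, Finset.sum_mul]
    refine norm_sum_le_of_le _ fun p hp => ?_
    rw [norm_mul]
    refine mul_le_mul ?_ (norm_sub_taylor_le ha.isOpen hu hp h0 hsq hK) (norm_nonneg _)
      (Finset.sum_nonneg fun _ _ => norm_nonneg _)
    rw [hC, Complex.norm_real, stencilPoly]
    refine norm_sum_le_of_le _ fun j _ => ?_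
    rw [norm_mul, norm_pow, Real.norm_of_nonneg h0.le]
    exact mul_le_of_le_one_right (norm_nonneg _) (pow_le_one₀ h0.le h1)
  have hbound2 : ‖∑ q ∈ axes, cderiv q.1 q.2 u x * ∑ p ∈ stencil, C p * A q p‖
      ≤ K * residualSize w x * h ^ 8 := by
    rw [mul_assoc, residualSize, Finset.sum_mul, Finset.mul_sum]
    refine norm_sum_le_of_le _ fun q hq => ?_
    have e : ∑ p ∈ stencil, C p * A q p = ∑ j ∈ Finset.range 8, ∑ k ∈ Finset.range 8,
        (h : ℂ) ^ (j + k) * ∑ p ∈ stencil, taylorA w x k q.1 q.2 p * (c p j : ℂ) := by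
      simp only [hC, hA, stencilPoly, Complex.ofReal_sum, Finset.sum_mul_sum]
      rw [Finset.sum_comm]
      refine Finset.sum_congr rfl fun j _ => ?_
      rw [Finset.sum_comm]
      refine Finset.sum_congr rfl fun k _ => ?_
      rw [Finset.mul_sum]
      refine Finset.sum_congr rfl fun p _ => ?_
      push_cast
      ring
    have hq8 : q.1 + q.2 ≤ 8 := by
      simp only [axes, Finset.mem_filter, Finset.mem_product, Finset.mem_range, mul_eq_zero] at hq
      omega
    rw [norm_mul, e]
    exact mul_le_mul (norm_cderiv_le (n := 8) ha.isOpen hu (hsq hx) (hK x hx) hq8)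
      (norm_sum_pow_mul_le h0 h1 8 _ fun s hs => hw.sum_taylorA_axes
        (fun j hj => hw.levelSystem_signedSolution hj) hq (by omega)) (norm_nonneg _)
      ((abs_nonneg _).trans (hK x hx 0 0 (Nat.zero_le 8)))
  rw [hsplit, add_mul]
  exact (norm_add_le _ _).trans (add_le_add hbound1 hbound2)

theorem IsDiffusion.realJet {Ω : Set (ℝ × ℝ)} {a : ℝ × ℝ → ℝ} (ha : IsDiffusion Ω a) {x : ℝ × ℝ}
    (hx : x ∈ Ω) : RealJet (aTilde a) x := fun k l hkl =>
  conj_cderiv ha.isOpen ((contDiffOn_aTilde ha).of_le (by exact_mod_cast hkl)) hx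

theorem IsDiffusion.norm_cderiv_le {Ω : Set (ℝ × ℝ)} {a : ℝ × ℝ → ℝ} (ha : IsDiffusion Ω a)
    {x : ℝ × ℝ} (hx : x ∈ Ω) {K : ℝ} (hK : JetBound (aTilde a) 6 K x) (k l : ℕ) (hkl : k + l ≤ 6) :
    ‖cderiv k l (aTilde a) x‖ ≤ K :=
  CompactFDM.norm_cderiv_le ha.isOpen (contDiffOn_aTilde ha) hx hK hkl

end CompactFDM

end

theorem mainTheorem3 :
    -- solvability of the leading-order system
    (∀ (Ω : Set (ℝ × ℝ)) (a : ℝ × ℝ → ℝ), CompactFDM.IsDiffusion Ω a → ∀ x ∈ Ω, ∀ M : ℕ,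
      ((∃ c : ℤ × ℤ → ℕ → ℝ,
          CompactFDM.InteriorSystem (CompactFDM.aTilde a) x M c 0 ∧
          ∃ p ∈ CompactFDM.stencil, c p 0 ≠ 0) ↔ M ≤ 6)) ∧
    -- coefficients for `M = 6`, chosen from the diffusion coefficient and the base point only
    ∃ c : (ℝ × ℝ → ℝ) → ℝ × ℝ → ℤ × ℤ → ℕ → ℝ,
      (∀ (Ω : Set (ℝ × ℝ)) (a : ℝ × ℝ → ℝ), CompactFDM.IsDiffusion Ω a → ∀ x ∈ Ω,
        -- solution of the full linear system, nonzero at leading order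
        (∀ j : ℕ, j ≤ 7 →
          CompactFDM.InteriorSystem (CompactFDM.aTilde a) x 6 (c a x) j) ∧
        (∃ p ∈ CompactFDM.stencil, c a x p 0 ≠ 0) ∧
        -- sign condition
        0 < c a x (0, 0) 0 ∧
        (∀ p ∈ CompactFDM.stencil, p ≠ (0, 0) → c a x p 0 < 0) ∧
        (∀ j : ℕ, 1 ≤ j → j ≤ 7 → 0 ≤ c a x (0, 0) j) ∧
        (∀ j : ℕ, 1 ≤ j → j ≤ 7 →
          ∀ p ∈ CompactFDM.stencil, p ≠ (0, 0) → c a x p j ≤ 0) ∧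
        (∀ h : ℝ, 0 < h → 0 < CompactFDM.stencilPoly 6 (c a x) (0, 0) h) ∧
        (∀ h : ℝ, 0 < h → ∀ p ∈ CompactFDM.stencil, p ≠ (0, 0) →
          CompactFDM.stencilPoly 6 (c a x) p h < 0) ∧
        -- sum condition
        (∀ j : ℕ, j ≤ 7 → ∑ p ∈ CompactFDM.stencil, c a x p j = 0)) ∧
      -- the coefficients are bounded in terms of `ã` and its derivatives at the base point
      (∀ K : ℝ, ∃ B : ℝ, ∀ (Ω : Set (ℝ × ℝ)) (a : ℝ × ℝ → ℝ), CompactFDM.IsDiffusion Ω a →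
        ∀ x ∈ Ω, CompactFDM.JetBound (CompactFDM.aTilde a) 6 K x →
          ∀ p ∈ CompactFDM.stencil, ∀ j : ℕ, j ≤ 7 → |c a x p j| ≤ B) ∧
      -- sixth-order consistency, with a constant depending only on bounds for `ã` and `u`
      (∀ K : ℝ, ∃ B : ℝ, ∀ (Ω : Set (ℝ × ℝ)) (a f u : ℝ × ℝ → ℝ),
        CompactFDM.IsDiffusion Ω a → ContDiffOn ℝ 8 u Ω → CompactFDM.SolvesPDE Ω a f u →
        ∀ (x : ℝ × ℝ) (h : ℝ), 0 < h → h ≤ 1 → CompactFDM.square x h ⊆ Ω →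
          CompactFDM.JetBound (CompactFDM.aTilde a) 6 K x →
          (∀ y ∈ CompactFDM.square x h, CompactFDM.JetBound u 8 K y) →
          ‖((∑ p ∈ CompactFDM.stencil,
                CompactFDM.stencilPoly 6 (c a x) p h * u (CompactFDM.shift x p h) : ℝ) : ℂ)
              - ∑ p ∈ CompactFDM.stencil,
                (CompactFDM.stencilPoly 6 (c a x) p h : ℂ) *
                  CompactFDM.taylorF (CompactFDM.aTilde a) (CompactFDM.fTilde a f) x 6 h p‖
            ≤ B * h ^ 8) := by
  refine ⟨fun Ω a _ x _ M => CompactFDM.exists_interiorSystem_iff _ x M,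
    fun a x => CompactFDM.signedSolution (CompactFDM.aTilde a) x, ?_, ?_, ?_⟩
  · intro Ω a ha x hx
    have hw := ha.realJet hx
    set c := CompactFDM.signedSolution (CompactFDM.aTilde a) x
    have hpos : ∀ j ≤ 7, 1 ≤ c (0, 0) j := fun j hj => CompactFDM.one_le_signedSolution _ x hj
    have hneg : ∀ p ∈ CompactFDM.stencil, p ≠ (0, 0) → ∀ j ≤ 7, c p j ≤ -1 := fun p hp h0 j hj =>
      CompactFDM.signedSolution_le _ x hp h0 hj
    refine ⟨fun j hj => (hw.levelSystem_signedSolution hj).interiorSystem,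
      ⟨(0, 0), by decide, ?_⟩, ?_, fun p hp h0 => ?_, fun j _ hj => ?_, fun j _ hj p hp h0 => ?_,
      fun h hh => ?_, fun h hh p hp h0 => ?_,
      fun j hj => (hw.levelSystem_signedSolution hj).sum_eq_zero hj⟩
    · linarith [hpos 0 (by norm_num)]
    · linarith [hpos 0 (by norm_num)]
    · linarith [hneg p hp h0 0 (by norm_num)]
    · linarith [hpos j hj]
    · linarith [hneg p hp h0 j hj]
    · refine Finset.sum_pos (fun j hj => ?_) ⟨0, by simp⟩
      rw [Finset.mem_range] at hj
      exact mul_pos (by linarith [hpos j (by omega)]) (pow_pos hh j)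
    · refine Finset.sum_neg (fun j hj => ?_) ⟨0, by simp⟩
      rw [Finset.mem_range] at hj
      exact mul_neg_of_neg_of_pos (by linarith [hneg p hp h0 j (by omega)]) (pow_pos hh j)
  · intro K
    obtain ⟨B, hB⟩ := CompactFDM.jetBounded_stencilSize K
    refine ⟨B, fun Ω a ha x hx hK p hp j hj => ?_⟩
    refine le_trans ?_ ((le_abs_self _).trans (hB _ x (ha.norm_cderiv_le hx hK)))
    refine (Finset.single_le_sum (f := fun j => ‖CompactFDM.signedSolution _ x p j‖)
      (fun _ _ => norm_nonneg _) (Finset.mem_range.2 (by omega : j < 8))).trans ?_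
    exact Finset.single_le_sum (f := fun p => ∑ j ∈ Finset.range 8,
      ‖CompactFDM.signedSolution _ x p j‖)
      (fun _ _ => Finset.sum_nonneg fun _ _ => norm_nonneg _) hp
  · intro K
    obtain ⟨B, hB⟩ := CompactFDM.jetBounded_stencilSize K
    obtain ⟨R, hR⟩ := CompactFDM.jetBounded_residualSize K
    -- This is the constant of `consistency_error_le` with both sizes replaced by their bounds in
    -- terms of `K`.
    refine ⟨B * (4 ^ 8 * K) + K * R, fun Ω a f u ha hu hs x h h0 h1 hsq hKa hK => ?_⟩
    have hxs : x ∈ CompactFDM.square x h := by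
      refine ⟨⟨?_, ?_⟩, ?_, ?_⟩ <;> linarith
    have hx := hsq hxs
    have hK0 : 0 ≤ K := (abs_nonneg _).trans (hK x hxs 0 0 (Nat.zero_le 8))
    refine (CompactFDM.consistency_error_le ha hu hs h0 h1 hsq hK (ha.realJet hx)).trans ?_
    have hb := (le_abs_self _).trans (hB _ x (ha.norm_cderiv_le hx hKa))
    have hr := (le_abs_self _).trans (hR _ x (ha.norm_cderiv_le hx hKa))
    gcongr
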